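/- **Setting.** Let $p$ be a prime, $k$ a field of characteristic $p$, $G$ a finite group with $p \mid |G|$, and $H\le G$ a subgroup of index prime to $p$. For a finite left $G$-set $X$, a representation $V$ of $X$ over $k$ consists of a $k$-vector space $V_x$ for every $x\in X$ and $k$-linear isomorphisms $V_g:V_x\to V_{gx}$ for all $g\in G$, $x\in X$, with $V_1=\mathrm{id}$ and $V_{g_2g_1}=V_{g_2}V_{g_1}$; morphisms are families of linear maps $V_x\to V'_x$ commuting with all $V_g,V'_g$. Let $\mathrm{Rep}(X)$ be the resulting abelian category and $\mathrm{StRep}(X)$ its stable category, i.e. the quotient by the morphisms that factor through a projective object. It is symmetric monoidal for $(V\otimes V')_x=V_x\otimes_k V'_x$, with unit $\mathbf 1$, $\mathbf 1_x=k$. A $G$-map $\alpha:Y\to X$ induces the $\otimes$-functor $\alpha^*:\mathrm{StRep}(X)\to\mathrm{StRep}(Y)$, $(\alpha^*V)_y=V_{\alpha(y)}$, and $\beta^*\alpha^*=(\alpha\beta)^*$. Define presheaves of abelian groups on finite $G$-sets: $\mathrm{StPic}(X)$ is the group of isomorphism classes of $\otimes$-invertible objects of $\mathrm{StRep}(X)$,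 and $\mathbb G_m(X)=\mathrm{Aut}_{\mathrm{StRep}(X)}(\mathbf 1)$. Let $U=G/H$, let $\alpha:U\to G/G$ be the projection and $\mathcal U=\{\alpha:U\to G/G\}$. Let $U^{(n)}$ be the product of $n$ copies of $U$, with its projections $\mathrm{pr}_i$, $\mathrm{pr}_{ij}$ (the latter onto the $i$-th and $j$-th factors). For a presheaf $P$ of abelian groups, $\check H^\bullet(\mathcal U,P)$ is the cohomology of the Čech complex with $P(U^{(n+1)})$ in degree $n\ge 0$ and with $d^n$ the alternating sum of the maps induced by the $n+2$ projections $U^{(n+2)}\to U^{(n+1)}$ that omit one factor. For a finite group $K$, let $T(K)$ be the group of stable isomorphism classes of endotrivial $kK$-modules, i.e. the group of isomorphism classes of $\otimes$-invertible objects in the stable category of finite-dimensional $kK$-modules. For $K=H$, taking the fibre at the coset $[1]\in G/H$, $V\mapsto \iota_H^*V=V_{[1]}$, is a $\otimes$-functor from $\mathrm{StRep}(G/H)$ to the stable category of all $kH$-modules. **Theorem.** (a) The image of $\alpha^*:\mathrm{StPic}(G/G)\to\mathrm{StPic}(U)$ is contained in $\check H^0(\mathcal U,\mathrm{StPic})=\mathrm{Ker}\big(\mathrm{pr}_1^*-\mathrm{pr}_2^*:\mathrm{StPic}(U)\to\mathrm{StPic}(U^{(2)})\big)$.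 (b) Let $w\in\check H^0(\mathcal U,\mathrm{StPic})$. There is an object $W\in\mathrm{StRep}(U)$ whose isomorphism class is $w$, and for every such $W$ there is an isomorphism $\xi:\mathrm{pr}_2^*W\to\mathrm{pr}_1^*W$ in $\mathrm{StRep}(U^{(2)})$. For all such $W$ and $\xi$ there is a unique $\zeta=\zeta(W,\xi)\in\mathbb G_m(U^{(3)})$ such that, as automorphisms of $\mathrm{pr}_3^*W$, $$\zeta\otimes \mathrm{pr}_3^*W=\mathrm{pr}_{13}^*(\xi)^{-1}\circ\mathrm{pr}_{12}^*(\xi)\circ\mathrm{pr}_{23}^*(\xi).$$ This $\zeta$ is a 2-cocycle in the Čech complex of $\mathcal U$ with coefficients in $\mathbb G_m$, and its class in $\check H^2(\mathcal U,\mathbb G_m)$ depends only on $w$, neither on the choice of $\xi$ nor on that of $W$. (c) The construction in (b) yields a well-defined group homomorphism $$z:\check H^0(\mathcal U,\mathrm{StPic})\to\check H^2(\mathcal U,\mathbb G_m),\qquad w\mapsto[\zeta(W,\xi)].$$ (d) $\mathrm{Im}\big(\alpha^*:\mathrm{StPic}(G/G)\to\mathrm{StPic}(U)\big)=\mathrm{Ker}(z)$.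 (e) The functor $\iota_H^*$ induces an isomorphism $\mathrm{StPic}(G/H)\cong T(H)$ (the class of $V$ is sent to the class in $T(H)$ whose members are isomorphic to $V_{[1]}$ in the stable category of $kH$-modules), and it restricts to an isomorphism from $\mathrm{Ker}(z)$ onto $\mathrm{Im}\big(T(G)\to T(H)\big)$, the image of restriction. -/

import Mathlib

open CategoryTheory MonoidalCategory

universe w v u

namespace StackRep

section StableCategory

variable (A : Type*) [Category* A] [Preadditive A]

/-- Two parallel morphisms are stably equal when their difference factors through a projective
object. -/
def stableRel : HomRel A := fun X Y f g =>
  ∃ (P : A) (_ : Projective P) (a : X ⟶ P) (b : P ⟶ Y), f - g = a ≫ b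

/-- Being stably equal is a congruence, so that the morphisms of the stable category are exactly
the classes of stably equal morphisms. -/
instance stableRel_congruence [Limits.HasZeroObject A]
    [Limits.HasBinaryBiproducts A] : Congruence (stableRel A) where
  equivalence := by
    intro X Y
    refine ⟨fun f => ?_, ?_, ?_⟩
    · exact ⟨_, Projective.zero_projective, 0, 0, by simp⟩
    · rintro f g ⟨P, hP, a, b, h⟩
      exact ⟨P, hP, -a, b, by rw [← neg_sub, h, Preadditive.neg_comp]⟩
    · rintro f g h ⟨P, hP, a, b, hab⟩ ⟨Q, hQ, c, d, hcd⟩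
      refine ⟨P ⊞ Q, inferInstance, Limits.biprod.lift a c, Limits.biprod.desc b d, ?_⟩
      rw [Limits.biprod.lift_desc, ← hab, ← hcd]; abel
  comp_left := by
    rintro X Y Z f g g' ⟨P, hP, a, b, h⟩
    exact ⟨P, hP, f ≫ a, b, by rw [← Preadditive.comp_sub, h, Category.assoc]⟩
  comp_right := by
    rintro X Y Z f f' g ⟨P, hP, a, b, h⟩
    exact ⟨P, hP, a, b ≫ g, by rw [← Preadditive.sub_comp, h, Category.assoc]⟩

/-- The stable category of `A`: the additive quotient of `A` by its projective objects. -/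
abbrev Stable := CategoryTheory.Quotient (stableRel A)

/-- The projection from a category to its stable category. -/
abbrev toStable : A ⥤ Stable A := CategoryTheory.Quotient.functor (stableRel A)

variable {A}

/-- An additive functor that preserves projective objects induces a functor on stable
categories. -/
abbrev stableMap {B : Type*} [Category* B] [Preadditive B] (F : A ⥤ B) [F.Additive]
    [F.PreservesProjectiveObjects] : Stable A ⥤ Stable B :=
  CategoryTheory.Quotient.lift (stableRel A) (F ⋙ toStable B) (by
    rintro X Y f g ⟨P, hP, a, b, h⟩
    exact CategoryTheory.Quotient.sound _ ⟨F.obj P, inferInstance, F.map a, F.map b,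
      by rw [← F.map_sub, h, F.map_comp]⟩)

variable (A) in
/-- The projective objects of a monoidal category form a tensor ideal. -/
class ProjectivesTensorIdeal [MonoidalCategory A] : Prop where
  tensorLeft (X : A) : (tensorLeft X).PreservesProjectiveObjects
  tensorRight (X : A) : (tensorRight X).PreservesProjectiveObjects

attribute [instance] ProjectivesTensorIdeal.tensorLeft ProjectivesTensorIdeal.tensorRight

section Monoidal

variable [MonoidalCategory A] [MonoidalPreadditive A] [ProjectivesTensorIdeal A]

instance : MonoidalCategoryStruct (Stable A) where
  tensorObj X Y := ⟨X.as ⊗ Y.as⟩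
  whiskerLeft X _ _ f := (stableMap (tensorLeft X.as)).map f
  whiskerRight f Y := (stableMap (tensorRight Y.as)).map f
  tensorHom {_ X₂ Y₁ _} f g :=
    (stableMap (tensorRight Y₁.as)).map f ≫ (stableMap (tensorLeft X₂.as)).map g
  tensorUnit := ⟨𝟙_ A⟩
  associator X Y Z := (toStable A).mapIso (α_ X.as Y.as Z.as)
  leftUnitor X := (toStable A).mapIso (λ_ X.as)
  rightUnitor X := (toStable A).mapIso (ρ_ X.as)

/-- The tensor product of the stable category is the one induced by that of `A`. -/
instance : MonoidalCategory (Stable A) where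
  tensorHom_def _ _ := rfl
  id_tensorHom_id X Y := by
    refine congrArg (toStable A).map (?_ : 𝟙 X.as ▷ Y.as ≫ X.as ◁ 𝟙 Y.as = 𝟙 _)
    simp
  tensorHom_comp_tensorHom {X₁ Y₁ Z₁ X₂ Y₂ Z₂} f₁ f₂ g₁ g₂ := by
    obtain ⟨f₁, rfl⟩ := (toStable A).map_surjective (X := X₁.as) (Y := Y₁.as) f₁
    obtain ⟨f₂, rfl⟩ := (toStable A).map_surjective (X := X₂.as) (Y := Y₂.as) f₂
    obtain ⟨g₁, rfl⟩ := (toStable A).map_surjective (X := Y₁.as) (Y := Z₁.as) g₁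
    obtain ⟨g₂, rfl⟩ := (toStable A).map_surjective (X := Y₂.as) (Y := Z₂.as) g₂
    refine congrArg (toStable A).map (?_ : (f₁ ▷ X₂.as ≫ Y₁.as ◁ f₂) ≫ g₁ ▷ Y₂.as ≫ Z₁.as ◁ g₂ =
      (f₁ ≫ g₁) ▷ X₂.as ≫ Z₁.as ◁ (f₂ ≫ g₂))
    simp only [← MonoidalCategory.tensorHom_def, tensorHom_comp_tensorHom]
  whiskerLeft_id X Y := congrArg (toStable A).map (MonoidalCategory.whiskerLeft_id X.as Y.as)
  id_whiskerRight X Y := congrArg (toStable A).map (MonoidalCategory.id_whiskerRight X.as Y.as)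
  associator_naturality {X₁ X₂ X₃ Y₁ Y₂ Y₃} f₁ f₂ f₃ := by
    obtain ⟨f₁, rfl⟩ := (toStable A).map_surjective (X := X₁.as) (Y := Y₁.as) f₁
    obtain ⟨f₂, rfl⟩ := (toStable A).map_surjective (X := X₂.as) (Y := Y₂.as) f₂
    obtain ⟨f₃, rfl⟩ := (toStable A).map_surjective (X := X₃.as) (Y := Y₃.as) f₃
    refine congrArg (toStable A).map (?_ :
      ((f₁ ▷ X₂.as ≫ Y₁.as ◁ f₂) ▷ X₃.as ≫ (Y₁.as ⊗ Y₂.as) ◁ f₃) ≫ (α_ _ _ _).hom =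
        (α_ _ _ _).hom ≫ f₁ ▷ (X₂.as ⊗ X₃.as) ≫ Y₁.as ◁ (f₂ ▷ X₃.as ≫ Y₂.as ◁ f₃))
    simp only [← MonoidalCategory.tensorHom_def, associator_naturality]
  leftUnitor_naturality {X Y} f := by
    obtain ⟨f, rfl⟩ := (toStable A).map_surjective (X := X.as) (Y := Y.as) f
    exact congrArg (toStable A).map (MonoidalCategory.leftUnitor_naturality f)
  rightUnitor_naturality {X Y} f := by
    obtain ⟨f, rfl⟩ := (toStable A).map_surjective (X := X.as) (Y := Y.as) f
    exact congrArg (toStable A).map (MonoidalCategory.rightUnitor_naturality f)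
  pentagon W X Y Z :=
    congrArg (toStable A).map (MonoidalCategory.pentagon W.as X.as Y.as Z.as)
  triangle X Y := congrArg (toStable A).map (MonoidalCategory.triangle X.as Y.as)

instance [SymmetricCategory A] : BraidedCategory (Stable A) where
  braiding X Y := (toStable A).mapIso (β_ X.as Y.as)
  braiding_naturality_right X Y Z f := by
    obtain ⟨f, rfl⟩ := (toStable A).map_surjective (X := Y.as) (Y := Z.as) f
    exact congrArg (toStable A).map (BraidedCategory.braiding_naturality_right X.as f)
  braiding_naturality_left {X Y} f Z := by
    obtain ⟨f, rfl⟩ := (toStable A).map_surjective (X := X.as) (Y := Y.as) f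
    exact congrArg (toStable A).map (BraidedCategory.braiding_naturality_left f Z.as)
  hexagon_forward X Y Z :=
    congrArg (toStable A).map (BraidedCategory.hexagon_forward X.as Y.as Z.as)
  hexagon_reverse X Y Z :=
    congrArg (toStable A).map (BraidedCategory.hexagon_reverse X.as Y.as Z.as)

instance [SymmetricCategory A] : SymmetricCategory (Stable A) where
  symmetry X Y := congrArg (toStable A).map (SymmetricCategory.symmetry X.as Y.as)

open Functor.LaxMonoidal Functor.OplaxMonoidal

/-- The functor induced on stable categories by a tensor functor is a tensor functor. -/
instance {B : Type*} [Category* B] [Preadditive B] [MonoidalCategory B] [MonoidalPreadditive B]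
    [ProjectivesTensorIdeal B] (F : A ⥤ B) [F.Additive] [F.PreservesProjectiveObjects]
    [F.Monoidal] : (stableMap F).Monoidal :=
  Functor.CoreMonoidal.toMonoidal
    { εIso := (toStable B).mapIso (Functor.Monoidal.εIso F)
      μIso X Y := (toStable B).mapIso (Functor.Monoidal.μIso F X.as Y.as)
      μIso_hom_natural_left := by
        intro X Y f Z
        obtain ⟨f, rfl⟩ := (toStable A).map_surjective (X := X.as) (Y := Y.as) f
        exact congrArg (toStable B).map (Functor.LaxMonoidal.μ_natural_left F f Z.as)
      μIso_hom_natural_right := by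
        intro X Y Z f
        obtain ⟨f, rfl⟩ := (toStable A).map_surjective (X := X.as) (Y := Y.as) f
        exact congrArg (toStable B).map (Functor.LaxMonoidal.μ_natural_right F Z.as f)
      associativity X Y Z :=
        congrArg (toStable B).map (Functor.LaxMonoidal.associativity F X.as Y.as Z.as)
      left_unitality X :=
        congrArg (toStable B).map (Functor.LaxMonoidal.left_unitality F X.as)
      right_unitality X :=
        congrArg (toStable B).map (Functor.LaxMonoidal.right_unitality F X.as) }

end Monoidal
end StableCategory
end StackRep

namespace StackRep
section Rep
variable (k : Type u) [Field k]

/-- Representations over `k` of a groupoid `C`: functors from `C` to `k`-vector spaces. -/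
abbrev Rp (C : Type w) [Groupoid.{v} C] := C ⥤ ModuleCat.{u} k

instance (V : ModuleCat.{u} k) : (ihom V).PreservesEpimorphisms where
  preserves {Y Z} f hf := by
    have : Projective V := ModuleCat.projective_of_free (Module.Basis.ofVectorSpace k V)
    rw [ModuleCat.epi_iff_surjective]
    intro g
    exact ⟨(Projective.factorThru (show V ⟶ Z from g) f : V ⟶ Y), Projective.factorThru_comp _ f⟩

instance (C : Type w) [Groupoid.{v} C] : MonoidalPreadditive (Rp k C) where
  whiskerLeft_zero := by intros; ext : 2; simp; rfl
  zero_whiskerRight := by intros; ext : 2; simp; rfl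
  whiskerLeft_add := by intros; ext : 2; simp; rfl
  add_whiskerRight := by intros; ext : 2; simp; rfl

instance (C : Type w) [Groupoid.{v} C] : ProjectivesTensorIdeal (Rp k C) := by
  have h (X : Rp k C) : (tensorLeft X).PreservesProjectiveObjects := by
    have : (ihom X).PreservesEpimorphisms := ⟨fun {Y Z} f hf => by
      have (c : C) : Epi (((ihom X).map f).app c) := by
        have : Epi (f.app c) := inferInstance
        have := (ihom (X.obj c)).map_epi (f.app c)
        rw [Functor.ihom_map, Functor.closedIhom_map_app]
        exact this
      exact NatTrans.epi_of_epi_app _⟩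
    exact Functor.preservesProjectiveObjects_of_adjunction_of_preservesEpimorphisms
      (ihom.adjunction X)
  refine ⟨h, fun X => ⟨fun {Y} hY => ?_⟩⟩
  exact Projective.of_iso (β_ X Y) ((h X).projective_obj hY)

variable {k} in
/-- Over a groupoid with at most one morphism between any two objects, a pointwise surjective
morphism of diagrams of vector spaces is surjective on limits. -/
lemma epi_of_isLimit_of_thin {J : Type w} [Groupoid.{v} J] [Quiver.IsThin J]
    {X Y : J ⥤ ModuleCat.{u} k} (τ : X ⟶ Y) [∀ j, Epi (τ.app j)]
    {c : Limits.Cone X} {d : Limits.Cone Y} (hc : Limits.IsLimit c) (hd : Limits.IsLimit d)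
    (f : c.pt ⟶ d.pt) (hf : ∀ j, f ≫ d.π.app j = c.π.app j ≫ τ.app j) : Epi f := by
  rw [ModuleCat.epi_iff_surjective]
  intro y
  let S : Setoid J := isIsomorphicSetoid J
  let r (j : J) : J := (Quotient.mk S j).out
  let φ (j : J) : r j ≅ j := (Quotient.exact (Quotient.out_eq (Quotient.mk S j))).some
  have hr {i j : J} (m : i ⟶ j) : r i = r j :=
    congrArg Quotient.out (Quotient.sound (s := S) ⟨asIso m⟩)
  have hs (j : J) : Function.Surjective (τ.app j) :=
    (ModuleCat.epi_iff_surjective _).1 inferInstance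
  choose x hx using fun j => hs j (d.π.app j y)
  let t (j : J) : X.obj j := X.map (φ j).hom (x (r j))
  have key {i j : J} (e : i = j) {l : J} (a : i ⟶ l) (b : j ⟶ l) :
      X.map a (x i) = X.map b (x j) := by
    subst e
    rw [Subsingleton.elim a b]
  have ht {i j : J} (m : i ⟶ j) : X.map m (t i) = t j := by
    have := key (hr m) ((φ i).hom ≫ m) (φ j).hom
    rw [X.map_comp] at this
    exact this
  have hτ (j : J) : τ.app j (t j) = d.π.app j y := by
    have h1 := ConcreteCategory.congr_hom (τ.naturality (φ j).hom) (x (r j))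
    have h2 := ConcreteCategory.congr_hom (d.w (φ j).hom) y
    simp only [ConcreteCategory.comp_apply] at h1 h2
    rw [← h2, ← hx, ← h1]
  let hc' := Limits.isLimitOfPreserves (forget (ModuleCat.{u} k)) hc
  let z := (Limits.Types.isLimitEquivSections hc').symm ⟨t, fun m => ht m⟩
  have hz (j : J) : c.π.app j z = t j :=
    Limits.Types.isLimitEquivSections_symm_apply hc' ⟨t, fun m => ht m⟩ j
  refine ⟨z, ?_⟩
  refine Limits.Concrete.isLimit_ext _ hd _ _ fun j => ?_
  have h3 := ConcreteCategory.congr_hom (hf j) z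
  simp only [ConcreteCategory.comp_apply] at h3
  rw [← hτ, ← hz]
  exact h3

/-- Restriction of representations along a faithful functor of groupoids preserves projective
objects. -/
instance {C D : Type*} [Groupoid C] [Groupoid D] [EssentiallySmall.{u} C]
    [LocallySmall.{u} D] (F : C ⥤ D) [F.Faithful] :
    ((Functor.whiskeringLeft C D (ModuleCat.{u} k)).obj F).PreservesProjectiveObjects := by
  have (d : D) : Limits.HasLimitsOfShape (StructuredArrow d F) (ModuleCat.{u} k) :=
    Limits.hasLimitsOfShape_of_essentiallySmall.{u} _ _
  have : (F.ran (H := ModuleCat.{u} k)).PreservesEpimorphisms := ⟨fun {X Y} τ hτ => by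
    have (d : D) : Epi ((F.ran.map τ).app d) := by
      let gr : Groupoid (StructuredArrow d F) := Groupoid.ofIsIso fun {a b} m => by
        have : IsIso ((StructuredArrow.proj d F).map m) := inferInstance
        exact isIso_of_reflects_iso m (StructuredArrow.proj d F)
      have : Quiver.IsThin (StructuredArrow d F) := fun a b => ⟨fun m n => by
        ext
        apply F.map_injective
        have h1 := StructuredArrow.w m
        rw [← StructuredArrow.w n] at h1
        exact (cancel_epi _).1 h1⟩
      have (j : StructuredArrow d F) :
          Epi ((Functor.whiskerLeft (StructuredArrow.proj d F) τ).app j) :=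
        inferInstanceAs (Epi (τ.app j.right))
      refine epi_of_isLimit_of_thin (Functor.whiskerLeft (StructuredArrow.proj d F) τ)
        (F.isPointwiseRightKanExtensionRanCounit X d)
        (F.isPointwiseRightKanExtensionRanCounit Y d) ((F.ran.map τ).app d) fun j => ?_
      have h1 := NatTrans.congr_app (F.ranCounit.naturality τ) j.right
      have h2 := (F.ran.map τ).naturality j.hom
      dsimp at h1 h2
      have h3 : (F.ran.map τ).app d ≫ (F.ran.obj Y).map j.hom ≫ (F.ranCounit.app Y).app j.right =
          ((F.ran.obj X).map j.hom ≫ (F.ranCounit.app X).app j.right) ≫ τ.app j.right := by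
        rw [← Category.assoc, ← h2, Category.assoc, h1, Category.assoc]
      exact h3
    exact NatTrans.epi_of_epi_app _⟩
  exact Functor.preservesProjectiveObjects_of_adjunction_of_preservesEpimorphisms
    (F.ranAdjunction (ModuleCat.{u} k))
end Rep
end StackRep

namespace StackRep

/-! ### Picard groups -/

/-- The Picard group of a symmetric monoidal category: the group of isomorphism classes of
tensor-invertible objects. -/
abbrev Pic (A : Type*) [Category* A] [MonoidalCategory A] := (Skeleton A)ˣ

/-- The homomorphism of Picard groups induced by a tensor functor; it sends the class of `V` to
the class of `F V`. -/
noncomputable def Pic.map {A B : Type*} [Category* A] [Category* B] [MonoidalCategory A]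
    [MonoidalCategory B] (F : A ⥤ B) [F.Monoidal] : Pic A →* Pic B :=
  Units.map (Skeleton.monoidHom F)

lemma monoidHom_toSkeleton {A B : Type*} [Category* A] [Category* B] [MonoidalCategory A]
    [MonoidalCategory B] (F : A ⥤ B) [F.Monoidal] (V : A) :
    Skeleton.monoidHom F (toSkeleton V) = toSkeleton (F.obj V) :=
  F.mapSkeleton_obj_toSkeleton V

/-- The automorphisms of the tensor unit form a commutative group under composition. -/
instance (A : Type*) [Category* A] [MonoidalCategory A] : CommGroup (Aut (𝟙_ A)) where
  mul_comm f g := by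
    ext
    change g.hom ≫ f.hom = f.hom ≫ g.hom
    rw [← cancel_epi (λ_ (𝟙_ A)).hom, ← MonoidalCategory.leftUnitor_naturality_assoc,
      MonoidalCategory.unitors_equal, ← MonoidalCategory.rightUnitor_naturality,
      ← MonoidalCategory.rightUnitor_naturality_assoc, ← MonoidalCategory.unitors_equal,
      ← MonoidalCategory.leftUnitor_naturality, MonoidalCategory.whisker_exchange_assoc]

/-- The homomorphism on automorphism groups of tensor units induced by a tensor functor, under the
identification of `F 𝟙` with `𝟙`. -/
def unitAutMap {A B : Type*} [Category* A] [Category* B] [MonoidalCategory A]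
    [MonoidalCategory B] (F : A ⥤ B) [F.Monoidal] : Aut (𝟙_ A) →* Aut (𝟙_ B) :=
  ((Functor.Monoidal.εIso F).symm.conjAut).toMonoidHom.comp (F.mapAut (𝟙_ A))

/-- The automorphism `ζ ⊗ M` of `M ≅ 𝟙 ⊗ M` given by an automorphism `ζ` of the tensor unit. -/
def unitAct {A : Type*} [Category* A] [MonoidalCategory A] (ζ : Aut (𝟙_ A)) (M : A) : M ≅ M :=
  (λ_ M).symm ≪≫ whiskerRightIso ζ M ≪≫ λ_ M

/-! ### Stable representations of groupoids -/

section Rep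

variable (k : Type u) [Field k]

/-- The stable category of representations over `k` of a groupoid `C`. -/
abbrev StRp (C : Type w) [Groupoid.{v} C] := Stable (Rp k C)

/-- Restriction of stable representations along a faithful functor of groupoids. -/
noncomputable abbrev stRes {C D : Type*} [Groupoid C] [Groupoid D] [EssentiallySmall.{u} C]
    [LocallySmall.{u} D] (F : C ⥤ D) [F.Faithful] : StRp k D ⥤ StRp k C :=
  stableMap ((Functor.whiskeringLeft C D (ModuleCat.{u} k)).obj F)

end Rep

/-! ### Finite `G`-sets -/

/-- A finite left `G`-set. -/
structure FinGSet (G : Type v) [Group G] where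
  /-- The underlying set. -/
  carrier : Type v
  [action : MulAction G carrier]
  [finite : Finite carrier]

attribute [instance] FinGSet.action FinGSet.finite

/-- The category of finite `G`-sets and `G`-equivariant maps. -/
instance (G : Type v) [Group G] : Category (FinGSet.{v} G) where
  Hom X Y := X.carrier →[G] Y.carrier
  id X := MulActionHom.id G
  comp f g := g.comp f

section GSets

variable {G : Type v} [Group G]

/-- The `G`-equivariant map underlying a morphism of finite `G`-sets. -/
def FinGSet.toMap {X Y : FinGSet.{v} G} (α : X ⟶ Y) : X.carrier →[G] Y.carrier := α

/-- The action groupoid of `G` on `X`: its objects are the elements of `X`, and a morphism from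
`x` to `y` is an element `g` of `G` with `g • x = y`. -/
@[ext]
structure ActionGroupoid (X : FinGSet.{v} G) where
  /-- The element of `X`. -/
  pt : X.carrier

/-- Composition in the action groupoid is multiplication in `G`. -/
instance (X : FinGSet.{v} G) : Groupoid (ActionGroupoid X) where
  Hom x y := { g : G // g • x.pt = y.pt }
  id x := ⟨1, one_smul G x.pt⟩
  comp a b := ⟨b.val * a.val, by rw [mul_smul, a.property, b.property]⟩
  id_comp a := Subtype.ext (mul_one a.val)
  comp_id a := Subtype.ext (one_mul a.val)
  assoc a b c := Subtype.ext (mul_assoc c.val b.val a.val).symm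
  inv a := ⟨a.val⁻¹, inv_smul_eq_iff.2 a.property.symm⟩
  inv_comp a := Subtype.ext (mul_inv_cancel a.val)
  comp_inv a := Subtype.ext (inv_mul_cancel a.val)

instance (X : FinGSet.{v} G) : Small.{u} (ActionGroupoid X) :=
  small_of_injective (f := ActionGroupoid.pt) fun _ _ h => ActionGroupoid.ext h

instance [Finite G] (X : FinGSet.{v} G) : LocallySmall.{u} (ActionGroupoid X) :=
  ⟨fun x y => inferInstanceAs (Small.{u} { g : G // g • x.pt = y.pt })⟩

instance [Finite G] : LocallySmall.{u} (SingleObj G) :=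
  ⟨fun _ _ => inferInstanceAs (Small.{u} G)⟩

/-- The functor between action groupoids induced by a `G`-map `α`: it is `α` on objects and the
identity on the group elements that are the morphisms. -/
def actionMap {X Y : FinGSet.{v} G} (α : X ⟶ Y) : ActionGroupoid X ⥤ ActionGroupoid Y where
  obj x := ⟨FinGSet.toMap α x.pt⟩
  map g := ⟨g.val, by rw [← map_smul, g.property]⟩
  map_id _ := rfl
  map_comp _ _ := rfl

instance {X Y : FinGSet.{v} G} (α : X ⟶ Y) : (actionMap α).Faithful where
  map_injective h := Subtype.ext (congrArg Subtype.val h :)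

/-- The `G`-orbit `G/H`. -/
def orbit [Finite G] (H : Subgroup G) : FinGSet.{v} G := ⟨G ⧸ H⟩

/-- The projection `G/H → G/G`. -/
def orbitProj [Finite G] (H : Subgroup G) : orbit H ⟶ orbit (⊤ : Subgroup G) :=
  show (G ⧸ H) →[G] (G ⧸ (⊤ : Subgroup G)) from
  { toFun := Subgroup.quotientMapOfLE le_top
    map_smul' := by rintro g ⟨x⟩; rfl }

/-- The functor from the one-object groupoid of `H` to the action groupoid of `G/H`, sending the
object to the coset of `1`. -/
def orbitIncl [Finite G] (H : Subgroup G) :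
    SingleObj H ⥤ ActionGroupoid (orbit H) where
  obj _ := ⟨((1 : G) : G ⧸ H)⟩
  map h := ⟨((show H from h) : G), by
    change (((show H from h) : G) • ((1 : G) : G ⧸ H)) = ((1 : G) : G ⧸ H)
    rw [MulAction.Quotient.smul_coe, QuotientGroup.eq]
    simp⟩
  map_id _ := rfl
  map_comp _ _ := rfl

instance [Finite G] (H : Subgroup G) : (orbitIncl H).Faithful where
  map_injective h := Subtype.ext (congrArg Subtype.val h :)

end GSets

/-! ### The presheaves of stable categories, of Picard groups and of units -/

section Presheaves

variable (k : Type u) [Field k] {G : Type v} [Group G] [Finite G]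

/-- The stable category of representations over `k` of the finite `G`-set `X`. -/
abbrev StRep (X : FinGSet.{v} G) := StRp k (ActionGroupoid X)

/-- The restriction functor `α^*` along a `G`-map `α`. -/
noncomputable abbrev pull {X Y : FinGSet.{v} G} (α : Y ⟶ X) : StRep k X ⥤ StRep k Y :=
  stRes k (actionMap α)

/-- The identity `β^* α^* V = (α ∘ β)^* V`. -/
noncomputable def pullTrans {X Y Z : FinGSet.{v} G} (β : Z ⟶ Y) (α : Y ⟶ X) (γ : Z ⟶ X) (h : β ≫ α = γ)
    (V : StRep k X) : (pull k β).obj ((pull k α).obj V) ≅ (pull k γ).obj V :=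
  eqToIso (by subst h; rfl)

variable (G) in
/-- The presheaf of Picard groups of the stable categories. -/
noncomputable def stPic : (FinGSet.{v} G)ᵒᵖ ⥤ CommGrpCat.{max v (u + 1)} where
  obj X := CommGrpCat.of (Pic (StRep k X.unop))
  map α := CommGrpCat.ofHom (Pic.map (pull k α.unop))
  map_id X := by
    ext w
    obtain ⟨V, hV⟩ := Quotient.exists_rep (w : Pic (StRep k X.unop)).val
    change Skeleton.monoidHom _ (w : Pic (StRep k X.unop)).val = (w : Pic (StRep k X.unop)).val
    rw [← hV]
    exact monoidHom_toSkeleton _ V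
  map_comp {X Y Z} α β := by
    ext w
    obtain ⟨V, hV⟩ := Quotient.exists_rep (w : Pic (StRep k X.unop)).val
    change Skeleton.monoidHom _ (w : Pic (StRep k X.unop)).val =
      Skeleton.monoidHom _ (Skeleton.monoidHom _ (w : Pic (StRep k X.unop)).val)
    rw [← hV]
    change Skeleton.monoidHom _ (toSkeleton V) =
      Skeleton.monoidHom _ (Skeleton.monoidHom _ (toSkeleton V))
    rw [monoidHom_toSkeleton, monoidHom_toSkeleton, monoidHom_toSkeleton]
    rfl

/-- The object `V` represents the class `w` in the Picard group. -/
def HasClass {X : FinGSet.{v} G} (w : (stPic k G).obj (Opposite.op X)) (V : StRep k X) : Prop :=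
  (show Pic (StRep k X) from w).val = toSkeleton V

/-- Since `α^* 𝟙 = 𝟙`, the map on units induced by `α` is the restriction `α^*`. -/
lemma unitAutMap_pull {X Y : FinGSet.{v} G} (α : Y ⟶ X) (ζ : Aut (𝟙_ (StRep k X))) :
    (unitAutMap (pull k α) ζ).hom = (pull k α).map ζ.hom := by
  have h : (unitAutMap (pull k α) ζ).hom =
      𝟙 (𝟙_ (StRep k Y)) ≫ (pull k α).map ζ.hom ≫ 𝟙 (𝟙_ (StRep k Y)) := rfl
  exact h.trans ((Category.id_comp _).trans (Category.comp_id _))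

variable (G) in
/-- The presheaf of automorphism groups of the tensor units of the stable categories. -/
noncomputable def unitsGm : (FinGSet.{v} G)ᵒᵖ ⥤ CommGrpCat.{max v u} where
  obj X := CommGrpCat.of (Aut (𝟙_ (StRep k X.unop)))
  map α := CommGrpCat.ofHom (unitAutMap (pull k α.unop))
  map_id X := by
    refine CommGrpCat.hom_ext (MonoidHom.ext fun (ζ : Aut (𝟙_ (StRep k X.unop))) => ?_)
    apply Aut.ext
    refine (unitAutMap_pull k _ ζ).trans ?_
    obtain ⟨f, hf⟩ := (toStable _).map_surjective ζ.hom
    change _ = ζ.hom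
    rw [← hf]
    rfl
  map_comp {X Y Z} α β := by
    refine CommGrpCat.hom_ext (MonoidHom.ext fun (ζ : Aut (𝟙_ (StRep k X.unop))) => ?_)
    apply Aut.ext
    refine (unitAutMap_pull k _ ζ).trans ?_
    change _ = (unitAutMap (pull k β.unop) (unitAutMap (pull k α.unop) ζ)).hom
    rw [unitAutMap_pull, unitAutMap_pull]
    obtain ⟨f, hf⟩ := (toStable _).map_surjective ζ.hom
    rw [← hf]
    rfl

end Presheaves

/-! ### Čech cohomology -/

section Cech

variable {G : Type v} [Group G] {U X : FinGSet.{v} G}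

/-- The fibre power `U ×_X ⋯ ×_X U` with `n + 1` factors. -/
def fiberPower (α : U ⟶ X) (n : ℕ) : FinGSet.{v} G :=
  let A : MulAction G
      { u : Fin (n + 1) → U.carrier // ∀ i j, FinGSet.toMap α (u i) = FinGSet.toMap α (u j) } :=
    { smul g u := ⟨fun i => g • u.val i, fun i j => by
        rw [map_smul, map_smul, u.property i j]⟩
      one_smul u := Subtype.ext (one_smul G u.val)
      mul_smul g h u := Subtype.ext (mul_smul g h u.val) }
  ⟨{ u : Fin (n + 1) → U.carrier // ∀ i j, FinGSet.toMap α (u i) = FinGSet.toMap α (u j) }⟩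

/-- The projection between fibre powers that selects the factors `s 0, s 1, …`. -/
def fiberProj (α : U ⟶ X) {m n : ℕ} (s : Fin (m + 1) → Fin (n + 1)) :
    fiberPower α n ⟶ fiberPower α m :=
  show (fiberPower α n).carrier →[G] (fiberPower α m).carrier from
  { toFun u := ⟨u.val ∘ s, fun i j => u.property (s i) (s j)⟩
    map_smul' _ _ := rfl }

/-- The projection of a fibre power onto its factor `i`, counted from `0`. -/
def factor (α : U ⟶ X) {n : ℕ} (i : Fin (n + 1)) : fiberPower α n ⟶ U :=
  show (fiberPower α n).carrier →[G] U.carrier from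
  { toFun u := u.val i
    map_smul' _ _ := rfl }

variable (P : (FinGSet.{v} G)ᵒᵖ ⥤ CommGrpCat.{w}) (α : U ⟶ X)

/-- The Čech cochains `P(U ×_X ⋯ ×_X U)`, with `n + 1` factors, of degree `n`. -/
abbrev CechCochain (n : ℕ) := P.obj (Opposite.op (fiberPower α n))

/-- The Čech differential from degree `n` to degree `n + 1`: the alternating product of the maps
induced by the `n + 2` projections that omit one factor. -/
def cechD (n : ℕ) : CechCochain P α n →* CechCochain P α (n + 1) :=
  ∏ i : Fin (n + 2), (P.map (fiberProj α i.succAbove).op).hom ^ ((-1 : ℤ) ^ (i : ℕ))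

/-- Čech cohomology in degree zero: the subgroup of `P(U)` on which the maps induced by the two
projections `U ×_X U → U` agree. -/
def cechH0 : Subgroup (P.obj (Opposite.op U)) :=
  ((P.map (factor α (0 : Fin 2)).op).hom / (P.map (factor α (1 : Fin 2)).op).hom).ker

/-- Čech cohomology in degree `n + 1`: cocycles modulo coboundaries. -/
abbrev CechH (n : ℕ) :=
  (cechD P α (n + 1)).ker ⧸ (cechD P α n).range.subgroupOf (cechD P α (n + 1)).ker

end Cech

/-! ### The obstruction to gluing -/

section Obstruction

variable (k : Type u) [Field k] {G : Type v} [Group G] [Finite G] {U X : FinGSet.{v} G}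
  (α : U ⟶ X)

/-- Isomorphisms `pr_2^* W ≅ pr_1^* W` over `U ×_X U`. -/
abbrev Gluing (W : StRep k U) :=
  (pull k (factor α (1 : Fin 2))).obj W ≅ (pull k (factor α (0 : Fin 2))).obj W

variable {k α}

/-- The isomorphism `pr_j^* W ≅ pr_i^* W` over a triple fibre power obtained by pulling back a
gluing along the projection `pr_{ij}` on the factors `i` and `j`. -/
noncomputable def Gluing.pullTo {W : StRep k U} (ξ : Gluing k α W) (i j : Fin 3) :
    (pull k (factor α j)).obj W ≅ (pull k (factor α i)).obj W :=
  (pullTrans k (fiberProj α ![i, j]) (factor α 1) (factor α j) rfl W).symm ≪≫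
    (pull k (fiberProj α ![i, j])).mapIso ξ ≪≫
    pullTrans k (fiberProj α ![i, j]) (factor α 0) (factor α i) rfl W

/-- The automorphism `pr_{13}^*(ξ)⁻¹ ∘ pr_{12}^*(ξ) ∘ pr_{23}^*(ξ)` of `pr_3^* W`. -/
noncomputable def Gluing.defect {W : StRep k U} (ξ : Gluing k α W) :
    (pull k (factor α (2 : Fin 3))).obj W ≅ (pull k (factor α (2 : Fin 3))).obj W :=
  ξ.pullTo 1 2 ≪≫ ξ.pullTo 0 1 ≪≫ (ξ.pullTo 0 2).symm

/-- `ζ` is the unit with `ζ ⊗ pr_3^* W = pr_{13}^*(ξ)⁻¹ ∘ pr_{12}^*(ξ) ∘ pr_{23}^*(ξ)`. -/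
def IsDefect {W : StRep k U} (ξ : Gluing k α W) (ζ : CechCochain (unitsGm k G) α 2) : Prop :=
  unitAct (show Aut (𝟙_ (StRep k (fiberPower α 2))) from ζ)
    ((pull k (factor α (2 : Fin 3))).obj W) = ξ.defect

end Obstruction

/-! ### The obstruction homomorphism for `G/H → G/G` -/

section ObstructionHom

variable (k : Type u) [Field k] {G : Type v} [Group G] [Finite G] (H : Subgroup G)

/-- The group `Ȟ⁰` of the cover `G/H → G/G` with coefficients in the Picard presheaf. -/
noncomputable abbrev PicH0 : Subgroup ((stPic k G).obj (Opposite.op (orbit H))) :=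
  cechH0 (stPic k G) (orbitProj H)

/-- The group `Ȟ²` of the cover `G/H → G/G` with coefficients in the units. -/
noncomputable abbrev UnitsH2 := CechH (unitsGm k G) (orbitProj H) 1

variable {k H}

/-- The homomorphism `z` sends the class of `W` to the class of the cocycle `ζ(W, ξ)`, for every
choice of the representative `W` and of the gluing `ξ`. -/
def IsObstructionHom (z : PicH0 k H →* UnitsH2 k H) : Prop :=
  ∀ (w : PicH0 k H) (W : StRep k (orbit H)), HasClass k w.val W →
    ∀ (ξ : Gluing k (orbitProj H) W) (ζ : CechCochain (unitsGm k G) (orbitProj H) 2),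
      IsDefect ξ ζ → ∃ hζ : ζ ∈ (cechD (unitsGm k G) (orbitProj H) 2).ker,
        z w = QuotientGroup.mk ⟨ζ, hζ⟩

end ObstructionHom

/-! ### Endotrivial modules -/

section Endotrivial

variable (k : Type u) [Field k] (K : Type v) [Group K] [Finite K]

/-- The representations of the group `K` with finite-dimensional underlying space, in the stable
category of all representations. -/
def finDim : ObjectProperty (StRp k (SingleObj K)) :=
  fun V => Module.Finite k (V.as.obj (SingleObj.star K))

instance : (finDim k K).IsMonoidal where
  prop_unit := inferInstanceAs (Module.Finite k k)
  prop_tensor V W hV hW := by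
    have : Module.Finite k (V.as.obj (SingleObj.star K)) := hV
    have : Module.Finite k (W.as.obj (SingleObj.star K)) := hW
    exact inferInstanceAs (Module.Finite k
      (TensorProduct k (V.as.obj (SingleObj.star K)) (W.as.obj (SingleObj.star K))))

/-- The stable category of finite-dimensional representations of `K`. -/
abbrev FinStab := (finDim k K).FullSubcategory

/-- The group `T(K)` of stable isomorphism classes of endotrivial modules: the Picard group of the
stable category of finite-dimensional representations of `K`. -/
abbrev EndoT := Pic (FinStab k K)

/-- The homomorphism from `T(K)` to the Picard group of the stable category of all
representations. -/
noncomputable def EndoT.incl : EndoT k K →* Pic (StRp k (SingleObj K)) :=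
  Pic.map (finDim k K).ι

variable {K} (H : Subgroup K)

/-- The inclusion of the one-object groupoid of a subgroup. -/
def subIncl : SingleObj H ⥤ SingleObj K := H.subtype.toFunctor

instance : (subIncl H).Faithful where
  map_injective h := Subtype.ext h

/-- Restriction of finite-dimensional stable representations from `K` to `H`. -/
noncomputable def finRes : FinStab k K ⥤ FinStab k H :=
  (finDim k H).lift ((finDim k K).ι ⋙ stRes k (subIncl H)) fun V => V.property

noncomputable instance : (finRes k H).Monoidal :=
  Functor.CoreMonoidal.toMonoidal
    { εIso := (finDim k H).isoMk (Functor.Monoidal.εIso (stRes k (subIncl H)))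
      μIso V W := (finDim k H).isoMk
        (Functor.Monoidal.μIso (stRes k (subIncl H)) V.obj W.obj)
      μIso_hom_natural_left f W := ObjectProperty.hom_ext _
        (Functor.LaxMonoidal.μ_natural_left (stRes k (subIncl H)) f.hom W.obj)
      μIso_hom_natural_right V f := ObjectProperty.hom_ext _
        (Functor.LaxMonoidal.μ_natural_right (stRes k (subIncl H)) V.obj f.hom)
      associativity V W Z := ObjectProperty.hom_ext _
        (Functor.LaxMonoidal.associativity (stRes k (subIncl H)) V.obj W.obj Z.obj)
      left_unitality V := ObjectProperty.hom_ext _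
        (Functor.LaxMonoidal.left_unitality (stRes k (subIncl H)) V.obj)
      right_unitality V := ObjectProperty.hom_ext _
        (Functor.LaxMonoidal.right_unitality (stRes k (subIncl H)) V.obj) }

/-- The restriction homomorphism `T(K) → T(H)`. -/
noncomputable def EndoT.res : EndoT k K →* EndoT k H := Pic.map (finRes k H)

/-- The homomorphism from the Picard group of the stable category of `K/H` to that of the stable
category of representations of `H`, induced by `V ↦ V_{[1]}`. -/
noncomputable def orbitPic :
    (stPic k K).obj (Opposite.op (orbit H)) →* Pic (StRp k (SingleObj H)) :=
  Pic.map (stRes k (orbitIncl H))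

end Endotrivial
end StackRep

open StackRep

/-!
Averaging over the fibres of `α : U ⟶ X` splits the unit of the adjunction `α^* ⊣ α_*`, because the
cardinalities of the fibres are invertible in `k`. A gluing that satisfies the cocycle condition is
a coaction on `α_* W`; composing it with the averaging gives an idempotent of `α_* W` in the stable
category, and a splitting of this idempotent descends `W` to `X`. Stable idempotents of a
finite-dimensional representation split because idempotents lift along the quotient of a
finite-dimensional algebra. Tensor-invertible objects are stably finite-dimensional, as the identity
of such an object factors through a finite-dimensional subrepresentation; and the descended object
is invertible because its evaluation map becomes an isomorphism after pulling back, which detects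
isomorphisms.

The unit `ζ(W, ξ)` measures the failure of the cocycle condition. Rescaling `ξ` by a unit `c`
multiplies `ζ` by the coboundary of `c`, so the class of `ζ` vanishes precisely when some gluing of
`W` is a descent datum. Part (e) follows since the action groupoid of `G/H` is equivalent to `H`.
-/

namespace StackRep

/-! ### Tensor-invertible objects -/

section TensorInvertible

variable {A B : Type*} [Category* A] [MonoidalCategory A] [Category* B] [MonoidalCategory B]

/-- An object with a two-sided tensor inverse. -/
def TensorInvertible (M : A) : Prop := ∃ N : A, Nonempty (M ⊗ N ≅ 𝟙_ A) ∧ Nonempty (N ⊗ M ≅ 𝟙_ A)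

lemma isUnit_toSkeleton_iff {M : A} : IsUnit (toSkeleton M) ↔ TensorInvertible M := by
  have toSkeleton_mul_eq_one_iff (M N : A) :
      toSkeleton M * toSkeleton N = 1 ↔ Nonempty (M ⊗ N ≅ 𝟙_ A) := by
    rw [← Skeleton.toSkeleton_tensorObj]
    exact toSkeleton_eq_toSkeleton_iff
  rw [isUnit_iff_exists]
  constructor
  · rintro ⟨w, hMw, hwM⟩
    obtain ⟨N, rfl⟩ := Quotient.exists_rep w
    exact ⟨N, (toSkeleton_mul_eq_one_iff M N).1 hMw, (toSkeleton_mul_eq_one_iff N M).1 hwM⟩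
  · rintro ⟨N, hMN, hNM⟩
    exact ⟨toSkeleton N, (toSkeleton_mul_eq_one_iff M N).2 hMN,
      (toSkeleton_mul_eq_one_iff N M).2 hNM⟩

namespace TensorInvertible

lemma of_iso {M N : A} (e : M ≅ N) (h : TensorInvertible M) : TensorInvertible N := by
  rw [← isUnit_toSkeleton_iff] at h ⊢
  rwa [← congr_toSkeleton_of_iso e]

lemma map (F : A ⥤ B) [F.Monoidal] {M : A} (h : TensorInvertible M) :
    TensorInvertible (F.obj M) := by
  rw [← isUnit_toSkeleton_iff] at h ⊢
  rw [← monoidHom_toSkeleton]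
  exact h.map _

lemma isEquivalence_tensorRight {M : A} (h : TensorInvertible M) :
    (tensorRight M).IsEquivalence := by
  obtain ⟨N, ⟨e⟩, ⟨f⟩⟩ := h
  exact (CategoryTheory.Equivalence.mk (tensorRight M) (tensorRight N)
    ((rightUnitorNatIso A).symm ≪≫ (tensoringRight A).mapIso e.symm ≪≫ tensorRightTensor M N)
    ((tensorRightTensor N M).symm ≪≫ (tensoringRight A).mapIso f ≪≫
      rightUnitorNatIso A)).isEquivalence_functor

lemma isEquivalence_tensorLeft {M : A} (h : TensorInvertible M) :
    (tensorLeft M).IsEquivalence := by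
  obtain ⟨N, ⟨e⟩, ⟨f⟩⟩ := h
  exact (CategoryTheory.Equivalence.mk (tensorLeft M) (tensorLeft N)
    ((leftUnitorNatIso A).symm ≪≫ (tensoringLeft A).mapIso f.symm ≪≫ tensorLeftTensor N M)
    ((tensorLeftTensor M N).symm ≪≫ (tensoringLeft A).mapIso e ≪≫
      leftUnitorNatIso A)).isEquivalence_functor

lemma isIso_evaluation {X Y : A} [ExactPairing X Y] (h : TensorInvertible X) :
    IsIso (ε_ X Y) := by
  have := h.isEquivalence_tensorLeft
  have counit_eq : (tensorLeftAdjunction X Y).counit.app (𝟙_ A) = Y ◁ (ρ_ X).hom ≫ ε_ X Y := by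
    simp [tensorLeftAdjunction, tensorLeftHomEquiv, unitors_equal]
  have : IsIso (Y ◁ (ρ_ X).hom ≫ ε_ X Y) :=
    counit_eq ▸ inferInstanceAs (IsIso ((tensorLeftAdjunction X Y).counit.app (𝟙_ A)))
  exact IsIso.of_isIso_comp_left (Y ◁ (ρ_ X).hom) _

end TensorInvertible

open Functor.LaxMonoidal Functor.OplaxMonoidal in
/-- The image of an exact pairing under a tensor functor. -/
@[reducible]
def exactPairingMap (F : A ⥤ B) [F.Monoidal] (X Y : A) [ExactPairing X Y] :
    ExactPairing (F.obj X) (F.obj Y) where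
  coevaluation' := ε F ≫ F.map (η_ X Y) ≫ δ F X Y
  evaluation' := μ F Y X ≫ F.map (ε_ X Y) ≫ η F
  coevaluation_evaluation' := by
    have map_coevaluation_evaluation : F.obj Y ◁ F.map (η_ X Y) ≫ F.obj Y ◁ δ F X Y ≫
        (α_ _ _ _).inv ≫ μ F Y X ▷ F.obj Y ≫ F.map (ε_ X Y) ▷ F.obj Y =
          μ F _ _ ≫ F.map ((ρ_ Y).hom ≫ (λ_ Y).inv) ≫ δ F _ _ := by
      rw [← ExactPairing.coevaluation_evaluation X Y]
      simp only [Functor.map_comp, Functor.Monoidal.map_whiskerLeft,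
        Functor.Monoidal.map_whiskerRight, Functor.Monoidal.map_associator_inv, Category.assoc,
        Functor.Monoidal.μ_δ, Functor.Monoidal.μ_δ_assoc, Category.comp_id]
    simp [reassoc_of% map_coevaluation_evaluation]
  evaluation_coevaluation' := by
    have map_evaluation_coevaluation : F.map (η_ X Y) ▷ F.obj X ≫ δ F X Y ▷ F.obj X ≫
        (α_ _ _ _).hom ≫ F.obj X ◁ μ F Y X ≫ F.obj X ◁ F.map (ε_ X Y) =
          μ F _ _ ≫ F.map ((λ_ X).hom ≫ (ρ_ X).inv) ≫ δ F _ _ := by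
      rw [← ExactPairing.evaluation_coevaluation X Y]
      simp only [Functor.map_comp, Functor.Monoidal.map_whiskerLeft,
        Functor.Monoidal.map_whiskerRight, Functor.Monoidal.map_associator, Category.assoc,
        Functor.Monoidal.μ_δ, Functor.Monoidal.μ_δ_assoc, Category.comp_id]
    simp [reassoc_of% map_evaluation_coevaluation]

end TensorInvertible

section UnitAct

variable {A B : Type*} [Category* A] [MonoidalCategory A] [Category* B] [MonoidalCategory B]

lemma unitAct_hom (ζ : Aut (𝟙_ A)) (M : A) :
    (unitAct ζ M).hom = (λ_ M).inv ≫ ζ.hom ▷ M ≫ (λ_ M).hom := rfl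

lemma unitAct_naturality (ζ : Aut (𝟙_ A)) {M N : A} (f : M ⟶ N) :
    (unitAct ζ M).hom ≫ f = f ≫ (unitAct ζ N).hom := by
  simp only [unitAct_hom, Category.assoc, ← leftUnitor_naturality, leftUnitor_inv_naturality_assoc,
    whisker_exchange_assoc]

lemma unitAct_mul (ζ η : Aut (𝟙_ A)) (M : A) :
    (unitAct (ζ * η) M).hom = (unitAct η M).hom ≫ (unitAct ζ M).hom := by
  simp [unitAct_hom, show (ζ * η).hom = η.hom ≫ ζ.hom from rfl]

lemma unitAct_one (M : A) : (unitAct (1 : Aut (𝟙_ A)) M).hom = 𝟙 M := by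
  simp [unitAct_hom, show (1 : Aut (𝟙_ A)).hom = 𝟙 _ from rfl]

lemma unitAct_bijective {M : A} (h : TensorInvertible M) :
    Function.Bijective (fun ζ : Aut (𝟙_ A) => unitAct ζ M) := by
  have := h.isEquivalence_tensorRight
  let e : Aut (𝟙_ A) ≃ (M ≅ M) :=
    (Functor.FullyFaithful.ofFullyFaithful (tensorRight M)).isoEquiv.trans
      (Iso.isoCongr (λ_ M) (λ_ M))
  exact e.bijective

lemma unitAct_tensor_left (ζ : Aut (𝟙_ A)) (M N : A) :
    (unitAct ζ (M ⊗ N)).hom = (unitAct ζ M).hom ▷ N := by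
  simp [unitAct_hom]

lemma unitAct_tensor_right [BraidedCategory A] (ζ : Aut (𝟙_ A)) (M N : A) :
    (unitAct ζ (M ⊗ N)).hom = M ◁ (unitAct ζ N).hom := by
  rw [← cancel_mono (β_ M N).hom, unitAct_naturality, unitAct_tensor_left]
  simp

open Functor.LaxMonoidal Functor.OplaxMonoidal in
lemma map_unitAct (F : A ⥤ B) [F.Monoidal] (ζ : Aut (𝟙_ A)) (M : A) :
    F.map (unitAct ζ M).hom = (unitAct (unitAutMap F ζ) (F.obj M)).hom := by
  have unitAutMap_hom : (unitAutMap F ζ).hom = ε F ≫ F.map ζ.hom ≫ η F := rfl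
  simp [unitAct_hom, unitAutMap_hom]

end UnitAct

section Pic

variable {A B : Type*} [Category* A] [Category* B] [MonoidalCategory A] [MonoidalCategory B]

namespace Pic

lemma exists_rep (w : Pic A) : ∃ V : A, w.val = toSkeleton V :=
  (Quotient.exists_rep w.val).imp fun _ hV => hV.symm

lemma map_val (F : A ⥤ B) [F.Monoidal] {w : Pic A} {V : A} (h : w.val = toSkeleton V) :
    (Pic.map F w).val = toSkeleton (F.obj V) :=
  (congrArg (Skeleton.monoidHom F) h).trans (monoidHom_toSkeleton F V)

lemma tensorInvertible {w : Pic A} {V : A} (h : w.val = toSkeleton V) : TensorInvertible V :=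
  isUnit_toSkeleton_iff.1 ⟨w, h⟩

lemma map_bijective_of_inverse (F : A ⥤ B) [F.Monoidal] (E : B ⥤ A) [E.Monoidal]
    (unitIso : ∀ V, Nonempty (E.obj (F.obj V) ≅ V))
    (counitIso : ∀ V, Nonempty (F.obj (E.obj V) ≅ V)) : Function.Bijective (Pic.map F) := by
  refine Function.bijective_iff_has_inverse.2 ⟨Pic.map E, fun w => ?_, fun w => ?_⟩
  · obtain ⟨V, hV⟩ := exists_rep w
    ext
    rw [map_val E (map_val F hV), hV]
    exact toSkeleton_eq_toSkeleton_iff.2 (unitIso V)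
  · obtain ⟨V, hV⟩ := exists_rep w
    ext
    rw [map_val F (map_val E hV), hV]
    exact toSkeleton_eq_toSkeleton_iff.2 (counitIso V)

end Pic
end Pic

/-! ### Pushforward along a map of `G`-sets -/

section Pushforward

variable {G : Type v} [Group G] {X Y : FinGSet.{v} G} (p : Y ⟶ X)

instance (X : FinGSet.{v} G) : Finite (ActionGroupoid X) :=
  Finite.of_injective ActionGroupoid.pt fun _ _ h => ActionGroupoid.ext h

lemma ActionGroupoid.source_eq_iff {y₁ y₂ z₁ z₂ : ActionGroupoid Y} {b₁ : y₁ ⟶ z₁}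
    {b₂ : y₂ ⟶ z₂} (h : b₁.val = b₂.val) : y₁ = y₂ ↔ z₁ = z₂ := by
  rw [ActionGroupoid.ext_iff, ActionGroupoid.ext_iff, ← b₁.property, ← b₂.property, h]
  exact (smul_left_cancel_iff _).symm

/-- The fibre of the functor of action groupoids induced by a `G`-map. -/
abbrev Fib (x : ActionGroupoid X) : Type v := { y : ActionGroupoid Y // (actionMap p).obj y = x }

namespace Fib

variable {p} {x x' : ActionGroupoid X} (a : x ⟶ x')

/-- The source of the lift of `a` that ends at the given element of a fibre. -/
def liftSource (y : Fib p x') : Fib p x :=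
  ⟨⟨a.val⁻¹ • y.val.pt⟩, ActionGroupoid.ext <|
    (map_smul (FinGSet.toMap p) a.val⁻¹ y.val.pt).trans <| inv_smul_eq_iff.2 <|
      (congrArg ActionGroupoid.pt y.property).trans a.property.symm⟩

/-- The lift of `a` that ends at the given element of a fibre. -/
def lift (y : Fib p x') : (y.liftSource a).val ⟶ y.val := ⟨a.val, smul_inv_smul _ _⟩

@[simp]
lemma lift_val (y : Fib p x') : (y.lift a).val = a.val := rfl

/-- Translation of fibres along an arrow of the base. -/
def congr : Fib p x ≃ Fib p x' where
  toFun := liftSource (Groupoid.inv a)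
  invFun := liftSource a
  left_inv y := Subtype.ext (ActionGroupoid.ext (smul_inv_smul a.val⁻¹ y.val.pt))
  right_inv y := Subtype.ext (ActionGroupoid.ext (inv_smul_smul a.val⁻¹ y.val.pt))

/-- The lift of `a` that starts at the given element of a fibre. -/
def liftFrom (y : Fib p x) : y.val ⟶ (congr a y).val :=
  ⟨a.val, show a.val • y.val.pt = a.val⁻¹⁻¹ • y.val.pt by rw [inv_inv]⟩

@[simp]
lemma liftFrom_val (y : Fib p x) : (y.liftFrom a).val = a.val := rfl

end Fib

variable {k : Type u} [Field k]

/-- Restriction of representations along a map of `G`-sets. -/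
abbrev res (k : Type u) [Field k] {X Y : FinGSet.{v} G} (p : Y ⟶ X) :
    Rp k (ActionGroupoid X) ⥤ Rp k (ActionGroupoid Y) :=
  (Functor.whiskeringLeft _ _ (ModuleCat.{u} k)).obj (actionMap p)

variable {p}

lemma Fib.π_map_congr (W : Rp k (ActionGroupoid Y)) {x : ActionGroupoid X} {y₁ y₂ : Fib p x}
    {z : ActionGroupoid Y} {b₁ : y₁.val ⟶ z} {b₂ : y₂.val ⟶ z} (h : b₁.val = b₂.val) :
    Limits.biproduct.π (fun y : Fib p x => W.obj y.val) y₁ ≫ W.map b₁ =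
      Limits.biproduct.π (fun y : Fib p x => W.obj y.val) y₂ ≫ W.map b₂ := by
  obtain rfl : y₁ = y₂ := Subtype.ext ((ActionGroupoid.source_eq_iff h).2 rfl)
  obtain rfl : b₁ = b₂ := Subtype.ext h
  rfl

variable (p)

/-- The pushforward of representations along a map of finite `G`-sets: the sum over the fibres. -/
noncomputable def push : Rp k (ActionGroupoid Y) ⥤ Rp k (ActionGroupoid X) where
  obj W :=
    { obj x := ⨁ fun y : Fib p x => W.obj y.val
      map a := Limits.biproduct.lift fun y =>
        Limits.biproduct.π _ (y.liftSource a) ≫ W.map (y.lift a)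
      map_id x := Limits.biproduct.hom_ext _ _ fun y => by
        rw [Limits.biproduct.lift_π, Category.id_comp]
        refine (Fib.π_map_congr W (b₂ := 𝟙 y.val) (y.lift_val (𝟙 x))).trans ?_
        rw [W.map_id, Category.comp_id]
      map_comp a b := Limits.biproduct.hom_ext _ _ fun y => by
        simp only [Category.assoc, Limits.biproduct.lift_π, Limits.biproduct.lift_π_assoc,
          ← W.map_comp]
        exact Fib.π_map_congr W rfl }
  map f :=
    { app x := Limits.biproduct.map fun y => f.app y.val
      naturality x x' a := Limits.biproduct.hom_ext _ _ fun y => by simp }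
  map_id W := by
    ext x : 2
    exact Limits.biproduct.hom_ext _ _ fun y => by simp
  map_comp f g := by
    ext x : 2
    exact Limits.biproduct.hom_ext _ _ fun y => by simp

section Components

variable {p} (W : Rp k (ActionGroupoid Y)) {x : ActionGroupoid X}

/-- The projection of a pushforward onto one summand. -/
noncomputable def pushπ (y : Fib p x) : ((push p).obj W).obj x ⟶ W.obj y.val :=
  Limits.biproduct.π (fun y : Fib p x => W.obj y.val) y

/-- The inclusion of one summand in a pushforward. -/
noncomputable def pushι (y : Fib p x) : W.obj y.val ⟶ ((push p).obj W).obj x :=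
  Limits.biproduct.ι (fun y : Fib p x => W.obj y.val) y

/-- A linear map to a pushforward given by its components. -/
noncomputable def pushLift {Z : ModuleCat.{u} k} (f : ∀ y : Fib p x, Z ⟶ W.obj y.val) :
    Z ⟶ ((push p).obj W).obj x :=
  Limits.biproduct.lift f

/-- A linear map from a pushforward given by its components. -/
noncomputable def pushDesc {Z : ModuleCat.{u} k} (f : ∀ y : Fib p x, W.obj y.val ⟶ Z) :
    ((push p).obj W).obj x ⟶ Z :=
  Limits.biproduct.desc f

variable {W} {Z Z' : ModuleCat.{u} k}

lemma push_hom_ext {f g : Z ⟶ ((push p).obj W).obj x}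
    (h : ∀ y, f ≫ pushπ W y = g ≫ pushπ W y) : f = g :=
  Limits.biproduct.hom_ext _ _ h

lemma push_hom_ext' {f g : ((push p).obj W).obj x ⟶ Z}
    (h : ∀ y, pushι W y ≫ f = pushι W y ≫ g) : f = g :=
  Limits.biproduct.hom_ext' _ _ h

variable (W)

@[simp]
lemma pushLift_π (f : ∀ y : Fib p x, Z ⟶ W.obj y.val) (y : Fib p x) :
    pushLift W f ≫ pushπ W y = f y :=
  Limits.biproduct.lift_π f y

@[simp]
lemma pushι_desc (f : ∀ y : Fib p x, W.obj y.val ⟶ Z) (y : Fib p x) :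
    pushι W y ≫ pushDesc W f = f y :=
  Limits.biproduct.ι_desc f y

lemma pushι_π (y : Fib p x) : pushι W y ≫ pushπ W y = 𝟙 _ :=
  Limits.biproduct.ι_π_self _ y

lemma pushι_π_ne {y y' : Fib p x} (h : y ≠ y') : pushι W y ≫ pushπ W y' = 0 :=
  Limits.biproduct.ι_π_ne _ h

lemma pushLift_desc [Fintype (Fib p x)] (f : ∀ y : Fib p x, Z ⟶ W.obj y.val)
    (g : ∀ y : Fib p x, W.obj y.val ⟶ Z') :
    pushLift W f ≫ pushDesc W g = ∑ y, f y ≫ g y := by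
  have lift_eq_sum : pushLift W f = ∑ y, f y ≫ pushι W y := push_hom_ext fun y => by
    rw [Preadditive.sum_comp, pushLift_π, Finset.sum_eq_single y]
    · rw [Category.assoc, pushι_π, Category.comp_id]
    · intro z _ hz
      rw [Category.assoc, pushι_π_ne _ hz, Limits.comp_zero]
    · exact fun hy => (hy (Finset.mem_univ y)).elim
  simp only [lift_eq_sum, Preadditive.sum_comp, Category.assoc, pushι_desc]

lemma push_obj_map_π {x' : ActionGroupoid X} (a : x ⟶ x') {y : Fib p x} {y' : Fib p x'}
    {b : y.val ⟶ y'.val} (h : b.val = a.val) :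
    ((push p).obj W).map a ≫ pushπ W y' = pushπ W y ≫ W.map b :=
  (Limits.biproduct.lift_π _ y').trans (Fib.π_map_congr W h.symm)

lemma ι_push_obj_map {x' : ActionGroupoid X} (a : x ⟶ x') {y : Fib p x} {y' : Fib p x'}
    {b : y.val ⟶ y'.val} (h : b.val = a.val) :
    pushι W y ≫ ((push p).obj W).map a = W.map b ≫ pushι W y' := by
  refine push_hom_ext fun z => ?_
  rw [Category.assoc, push_obj_map_π W a (z.lift_val a), Category.assoc]
  have hz : y = z.liftSource a ↔ y' = z := by
    rw [Subtype.ext_iff, Subtype.ext_iff, ActionGroupoid.source_eq_iff (b₂ := z.lift a) h]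
  by_cases hyz : y' = z
  · obtain rfl := hyz
    obtain rfl := hz.2 rfl
    obtain rfl : b = y'.lift a := Subtype.ext h
    rw [reassoc_of% pushι_π W (y'.liftSource a), pushι_π, Category.comp_id]
  · rw [reassoc_of% pushι_π_ne W (mt hz.1 hyz), pushι_π_ne W hyz, Limits.zero_comp,
      Limits.comp_zero]

variable {W}

@[simp]
lemma push_map_π {V W : Rp k (ActionGroupoid Y)} (f : V ⟶ W) (y : Fib p x) :
    ((push p).map f).app x ≫ pushπ W y = pushπ V y ≫ f.app y.val :=
  Limits.biproduct.map_π (fun y : Fib p x => f.app y.val) y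

@[simp]
lemma ι_push_map {V W : Rp k (ActionGroupoid Y)} (f : V ⟶ W) (y : Fib p x) :
    pushι V y ≫ ((push p).map f).app x = f.app y.val ≫ pushι W y :=
  Limits.biproduct.ι_map (fun y : Fib p x => f.app y.val) y

end Components

instance : (push (k := k) p).Additive where
  map_add {V W f g} := by
    ext x : 2
    refine push_hom_ext fun y => ?_
    rw [NatTrans.app_add, Preadditive.add_comp, push_map_π, push_map_π, push_map_π,
      NatTrans.app_add, Preadditive.comp_add]

/-- A morphism to a (restricted) pushforward, given by components compatible with the lifts of the
arrows of the base. -/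
noncomputable def pushHom {C : Type*} [Category* C] (E : C ⥤ ActionGroupoid X)
    {V : C ⥤ ModuleCat.{u} k} {W : Rp k (ActionGroupoid Y)}
    (φ : ∀ c (y : Fib p (E.obj c)), V.obj c ⟶ W.obj y.val)
    (hφ : ∀ {c c'} (a : c ⟶ c') {y : Fib p (E.obj c)} {y' : Fib p (E.obj c')}
      (b : y.val ⟶ y'.val), b.val = (E.map a).val → V.map a ≫ φ c' y' = φ c y ≫ W.map b) :
    V ⟶ E ⋙ (push p).obj W where
  app c := pushLift W (φ c)
  naturality c c' a := push_hom_ext fun y' => by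
    rw [Category.assoc, Category.assoc, pushLift_π, Functor.comp_map,
      push_obj_map_π W _ (y'.lift_val (E.map a)), hφ a _ (y'.lift_val (E.map a)),
      reassoc_of% pushLift_π W (φ c)]

variable {p} in
@[simp]
lemma pushHom_π {C : Type*} [Category* C] (E : C ⥤ ActionGroupoid X)
    {V : C ⥤ ModuleCat.{u} k} {W : Rp k (ActionGroupoid Y)}
    (φ : ∀ c (y : Fib p (E.obj c)), V.obj c ⟶ W.obj y.val) (hφ) (c : C) (y : Fib p (E.obj c)) :
    (pushHom p E φ hφ).app c ≫ pushπ W y = φ c y :=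
  pushLift_π W (φ c) y

section Transport

variable {p} (V : Rp k (ActionGroupoid X)) {x x' : ActionGroupoid X}

/-- Transport from the value of a representation at the image of an element of a fibre. -/
def fibIso (y : Fib p x) : V.obj ((actionMap p).obj y.val) ≅ V.obj x :=
  V.mapIso (eqToIso y.property)

@[simp]
lemma fibIso_self (y : ActionGroupoid Y) : fibIso V (⟨y, rfl⟩ : Fib p _) = Iso.refl _ :=
  V.mapIso_refl _

lemma fibIso_hom_map (a : x ⟶ x') {y : Fib p x} {y' : Fib p x'} {b : y.val ⟶ y'.val}
    (h : b.val = a.val) :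
    (fibIso V y).hom ≫ V.map a = V.map ((actionMap p).map b) ≫ (fibIso V y').hom := by
  obtain ⟨y, rfl⟩ := y
  obtain ⟨y', rfl⟩ := y'
  obtain rfl : a = (actionMap p).map b := Subtype.ext h.symm
  simp

lemma map_fibIso_inv (a : x ⟶ x') {y : Fib p x} {y' : Fib p x'} {b : y.val ⟶ y'.val}
    (h : b.val = a.val) :
    V.map a ≫ (fibIso V y').inv = (fibIso V y).inv ≫ V.map ((actionMap p).map b) := by
  rw [Iso.comp_inv_eq, Category.assoc, Iso.eq_inv_comp, fibIso_hom_map V a h]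

variable {V} {V' : Rp k (ActionGroupoid X)}

lemma fibIso_hom_naturality (f : V ⟶ V') (y : Fib p x) :
    (fibIso V y).hom ≫ f.app x = f.app _ ≫ (fibIso V' y).hom :=
  f.naturality _

lemma fibIso_inv_naturality (f : V ⟶ V') (y : Fib p x) :
    f.app x ≫ (fibIso V' y).inv = (fibIso V y).inv ≫ f.app _ :=
  (f.naturality _).symm

lemma fibIso_inv_π (W : Rp k (ActionGroupoid Y)) (y : Fib p x)
    (z : Fib p ((actionMap p).obj y.val)) :
    (fibIso ((push p).obj W) y).inv ≫ pushπ W z = pushπ W ⟨z.val, z.property.trans y.property⟩ := by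
  obtain ⟨y, rfl⟩ := y
  simp

lemma pushι_fibIso_hom (W : Rp k (ActionGroupoid Y)) (y : Fib p x) :
    pushι W ⟨y.val, rfl⟩ ≫ (fibIso ((push p).obj W) y).hom = pushι W y := by
  obtain ⟨y, rfl⟩ := y
  simp

end Transport

/-! ### The two adjunctions and the averaged trace -/

/-- The morphism to a pushforward whose components are the transports: the unit of the adjunction
between restriction and pushforward. -/
noncomputable def toPush (V : Rp k (ActionGroupoid X)) : V ⟶ (push p).obj (actionMap p ⋙ V) :=
  pushHom p (𝟭 _) (W := actionMap p ⋙ V) (fun _ y => (fibIso V y).inv)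
    fun a _ _ _ h => map_fibIso_inv V a h

variable {p} in
@[simp]
lemma toPush_π (V : Rp k (ActionGroupoid X)) {x : ActionGroupoid X} (y : Fib p x) :
    (toPush p V).app x ≫ pushπ (actionMap p ⋙ V) y = (fibIso V y).inv :=
  pushHom_π (𝟭 _) (W := actionMap p ⋙ V) _ _ x y

/-- The morphism from a pushforward whose components are the transports, i.e. the trace: the counit
of the adjunction between pushforward and restriction. -/
noncomputable def trace (V : Rp k (ActionGroupoid X)) : (push p).obj (actionMap p ⋙ V) ⟶ V where
  app x := pushDesc (actionMap p ⋙ V) fun y => (fibIso V y).hom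
  naturality x x' a := push_hom_ext' fun y => by
    rw [reassoc_of% ι_push_obj_map (actionMap p ⋙ V) a (y.liftFrom_val a), pushι_desc,
      reassoc_of% pushι_desc (actionMap p ⋙ V), fibIso_hom_map V a (y.liftFrom_val a)]

variable {p} in
@[simp]
lemma ι_trace (V : Rp k (ActionGroupoid X)) {x : ActionGroupoid X} (y : Fib p x) :
    pushι (actionMap p ⋙ V) y ≫ (trace p V).app x = (fibIso V y).hom :=
  pushι_desc (actionMap p ⋙ V) _ y

/-- Pushforward is right adjoint to restriction. -/
noncomputable def resPushAdj : res k p ⊣ push p :=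
  Adjunction.mkOfUnitCounit
    { unit :=
        { app := toPush p
          naturality V V' f := by
            ext x : 2
            refine push_hom_ext (W := actionMap p ⋙ V') fun y => ?_
            have push_map_res := push_map_π ((res k p).map f) y
            dsimp at push_map_res ⊢
            rw [Category.assoc, Category.assoc, toPush_π, push_map_res,
              reassoc_of% toPush_π V, fibIso_inv_naturality] }
      counit :=
        { app W :=
            { app y := pushπ W ⟨y, rfl⟩
              naturality y y' b := push_obj_map_π W ((actionMap p).map b) rfl }
          naturality W W' f := by
            ext y : 2
            exact push_map_π f _ }
      left_triangle := by
        ext V y : 4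
        have := toPush_π V (⟨y, rfl⟩ : Fib p _)
        simp_all
      right_triangle := by
        ext W x : 4
        refine push_hom_ext fun y => ?_
        dsimp
        rw [Category.id_comp, Category.id_comp, Category.assoc, push_map_π,
          reassoc_of% toPush_π ((push p).obj W) y, fibIso_inv_π] }

/-- The inclusion of a representation in the restriction of its pushforward: the unit of the
adjunction between pushforward and restriction. -/
noncomputable def summandIncl (W : Rp k (ActionGroupoid Y)) :
    W ⟶ actionMap p ⋙ (push p).obj W where
  app y := pushι W ⟨y, rfl⟩
  naturality y y' b :=
    (ι_push_obj_map W ((actionMap p).map b) (y := ⟨y, rfl⟩) (y' := ⟨y', rfl⟩) (b := b) rfl).symm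

/-- Pushforward is left adjoint to restriction. -/
noncomputable def pushResAdj : push p ⊣ res k p :=
  Adjunction.mkOfUnitCounit
    { unit :=
        { app := summandIncl p
          naturality W W' f := by
            ext y : 2
            exact (ι_push_map f _).symm }
      counit :=
        { app := trace p
          naturality V V' f := by
            ext x : 2
            refine push_hom_ext' (W := actionMap p ⋙ V) fun y => ?_
            have ι_push_map_res := ι_push_map ((res k p).map f) y
            dsimp at ι_push_map_res ⊢
            rw [reassoc_of% ι_push_map_res, ι_trace, reassoc_of% ι_trace V,
              fibIso_hom_naturality] }
      left_triangle := by
        ext W x : 4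
        refine push_hom_ext' fun y => ?_
        dsimp
        rw [Category.id_comp, Category.comp_id, reassoc_of% ι_push_map (summandIncl p W) y,
          ι_trace]
        exact pushι_fibIso_hom W y
      right_triangle := by
        ext V y : 4
        dsimp
        rw [Category.id_comp]
        exact (ι_trace V ⟨y, rfl⟩).trans (congrArg Iso.hom (fibIso_self V y)) }

instance : (res k p).PreservesEpimorphisms where
  preserves f _ :=
    have (y : ActionGroupoid Y) : Epi (((res k p).map f).app y) :=
      inferInstanceAs (Epi (f.app ((actionMap p).obj y)))
    NatTrans.epi_of_epi_app _

instance : (push (k := k) p).PreservesProjectiveObjects :=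
  Functor.preservesProjectiveObjects_of_adjunction_of_preservesEpimorphisms (pushResAdj p)

/-- The trace divided by the cardinalities of the fibres. It is meant for fibres whose cardinality
is nonzero in `k`. -/
noncomputable def averagedTrace : res k p ⋙ push p ⟶ 𝟭 (Rp k (ActionGroupoid X)) where
  app V :=
    { app x := (Nat.card (Fib p x) : k)⁻¹ • (trace p V).app x
      naturality x x' a := by
        rw [Linear.comp_smul, Linear.smul_comp, Nat.card_congr (Fib.congr (p := p) a)]
        exact congrArg _ ((trace p V).naturality a) }
  naturality V V' f := by
    ext x : 2
    have trace_naturality := congr_app ((pushResAdj p).counit.naturality f) x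
    exact (Linear.comp_smul ..).trans <|
      (congrArg _ trace_naturality).trans (Linear.smul_comp ..).symm

lemma toPush_averagedTrace (h : ∀ x : ActionGroupoid X, (Nat.card (Fib p x) : k) ≠ 0)
    (V : Rp k (ActionGroupoid X)) : toPush p V ≫ (averagedTrace p).app V = 𝟙 V := by
  ext x : 2
  have := Fintype.ofFinite (Fib p x)
  calc (toPush p V).app x ≫ ((Nat.card (Fib p x) : k)⁻¹ • (trace p V).app x)
      = (Nat.card (Fib p x) : k)⁻¹ • ((toPush p V).app x ≫ (trace p V).app x) :=
        Linear.comp_smul ..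
    _ = (Nat.card (Fib p x) : k)⁻¹ • ∑ y : Fib p x, (fibIso V y).inv ≫ (fibIso V y).hom :=
        congrArg _ (pushLift_desc (x := x) (actionMap p ⋙ V) _ _)
    _ = (Nat.card (Fib p x) : k)⁻¹ • (Nat.card (Fib p x) : k) • 𝟙 (V.obj x) := by
        simp [← Nat.cast_smul_eq_nsmul k]
    _ = 𝟙 (V.obj x) := inv_smul_smul₀ (h x) _

end Pushforward

/-! ### Descent along a functor whose unit splits -/

section Descent

variable {C D : Type*} [Category* C] [Category* D] {F : C ⥤ D} {R : D ⥤ C} (adj : F ⊣ R)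

/-- A coaction on `W` of the comonad of an adjunction: an unbundled `Comonad.Coalgebra` of
`adj.toComonad`, with the comonad spelled out. -/
structure IsCoaction {W : D} (ρ : W ⟶ F.obj (R.obj W)) : Prop where
  coassoc : ρ ≫ F.map (R.map ρ) = ρ ≫ F.map (adj.unit.app (R.obj W))
  counit : ρ ≫ adj.counit.app W = 𝟙 W

variable {adj} (s : F ⋙ R ⟶ 𝟭 C)

/-- The endomorphism of `R W` that averages a coaction on `W` by means of a retraction `s` of the
unit. Its image is the object that descends `W`. -/
def averaging {W : D} (ρ : W ⟶ F.obj (R.obj W)) : R.obj W ⟶ R.obj W :=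
  R.map ρ ≫ s.app (R.obj W)

variable {W : D} {ρ : W ⟶ F.obj (R.obj W)}

lemma averaging_comp_map (hρ : IsCoaction adj ρ) :
    averaging s ρ ≫ R.map ρ = averaging s ρ ≫ adj.unit.app (R.obj W) := by
  have s_coaction := s.naturality (R.map ρ)
  have s_unit := s.naturality (adj.unit.app (R.obj W))
  dsimp at s_coaction s_unit
  rw [averaging, Category.assoc, Category.assoc, ← s_coaction, ← s_unit, ← R.map_comp_assoc,
    ← R.map_comp_assoc, hρ.coassoc]

variable {s}

lemma averaging_idem (hs : ∀ X, adj.unit.app X ≫ s.app X = 𝟙 X) (hρ : IsCoaction adj ρ) :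
    averaging s ρ ≫ averaging s ρ = averaging s ρ :=
  calc averaging s ρ ≫ averaging s ρ
      = (averaging s ρ ≫ R.map ρ) ≫ s.app (R.obj W) := (Category.assoc ..).symm
    _ = averaging s ρ ≫ adj.unit.app (R.obj W) ≫ s.app (R.obj W) := by
        rw [averaging_comp_map s hρ, Category.assoc]
    _ = averaging s ρ := by rw [hs]; exact Category.comp_id _

lemma IsCoaction.nonempty_iso_of_split (hs : ∀ X, adj.unit.app X ≫ s.app X = 𝟙 X)
    (hρ : IsCoaction adj ρ) {V : C} (r : R.obj W ⟶ V) (i : V ⟶ R.obj W) (hir : i ≫ r = 𝟙 V)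
    (hri : r ≫ i = averaging s ρ) : Nonempty (F.obj V ≅ W) := by
  have equalizes : i ≫ R.map ρ = i ≫ adj.unit.app (R.obj W) := by
    have hi : i = i ≫ averaging s ρ := by rw [← hri, reassoc_of% hir]
    rw [hi, Category.assoc, averaging_comp_map s hρ, Category.assoc]
  refine ⟨⟨F.map i ≫ adj.counit.app W, ρ ≫ F.map r, ?_, ?_⟩⟩
  · have counit_naturality := adj.counit.naturality ρ
    dsimp at counit_naturality
    rw [Category.assoc, ← reassoc_of% counit_naturality, ← F.map_comp_assoc, equalizes,
      F.map_comp_assoc, adj.left_triangle_components_assoc, ← F.map_comp, hir, F.map_id]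
  · rw [Category.assoc, ← F.map_comp_assoc, hri, averaging, F.map_comp, Category.assoc,
      reassoc_of% hρ.coassoc, ← F.map_comp_assoc, hs, F.map_id, Category.id_comp, hρ.counit]

lemma isIso_of_isIso_map_of_retraction (hs : ∀ X, adj.unit.app X ≫ s.app X = 𝟙 X) {X Y : C}
    (f : X ⟶ Y) [IsIso (F.map f)] : IsIso f := by
  have s_naturality := s.naturality f
  have unit_naturality := adj.unit.naturality f
  dsimp at s_naturality unit_naturality
  refine ⟨adj.unit.app Y ≫ R.map (inv (F.map f)) ≫ s.app X, ?_, ?_⟩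
  · rw [reassoc_of% unit_naturality, ← R.map_comp_assoc, IsIso.hom_inv_id, R.map_id,
      Category.id_comp, hs]
  · rw [Category.assoc, Category.assoc, ← s_naturality, ← R.map_comp_assoc, IsIso.inv_hom_id,
      R.map_id, Category.id_comp, hs]

end Descent

/-! ### Stable categories -/

section Stable

variable {A B : Type*} [Category* A] [Preadditive A] [Category* B] [Preadditive B]
  {F : A ⥤ B} [F.Additive] [F.PreservesProjectiveObjects]
  {R : B ⥤ A} [R.Additive] [R.PreservesProjectiveObjects]

/-- The natural transformation of stable functors defined by `F ⋙ R ⟶ 𝟭`. -/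
def stableToId (s : F ⋙ R ⟶ 𝟭 A) : stableMap F ⋙ stableMap R ⟶ 𝟭 (Stable A) where
  app X := (toStable A).map (s.app X.as)
  naturality X Y f := by
    obtain ⟨f, rfl⟩ := (toStable A).map_surjective (X := X.as) (Y := Y.as) f
    exact congrArg (toStable A).map (s.naturality f)

/-- The natural transformation of stable functors defined by `𝟭 ⟶ F ⋙ R`. -/
def stableFromId (s : 𝟭 A ⟶ F ⋙ R) : 𝟭 (Stable A) ⟶ stableMap F ⋙ stableMap R where
  app X := (toStable A).map (s.app X.as)
  naturality X Y f := by
    obtain ⟨f, rfl⟩ := (toStable A).map_surjective (X := X.as) (Y := Y.as) f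
    exact congrArg (toStable A).map (s.naturality f)

/-- The adjunction of stable functors induced by an adjunction. -/
def stableAdj (adj : F ⊣ R) : stableMap F ⊣ stableMap R :=
  Adjunction.mkOfUnitCounit
    { unit := stableFromId adj.unit
      counit := stableToId adj.counit
      left_triangle := by
        ext X
        exact (congrArg (_ ≫ ·) (Category.id_comp _)).trans
          (congrArg (toStable B).map (adj.left_triangle_components X.as))
      right_triangle := by
        ext X
        exact (congrArg (_ ≫ ·) (Category.id_comp _)).trans
          (congrArg (toStable A).map (adj.right_triangle_components X.as)) }

lemma toStable_map_eq_iff [Limits.HasZeroObject A] [Limits.HasBinaryBiproducts A] {X Y : A}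
    (f g : X ⟶ Y) : (toStable A).map f = (toStable A).map g ↔ stableRel A f g :=
  CategoryTheory.Quotient.functor_map_eq_iff _ f g

end Stable

/-! ### Splitting stable idempotents -/

section Idempotents

lemma exists_isIdempotentElem_sub_mem_of_isArtinianRing {R : Type*} [CommRing R]
    [IsArtinianRing R] {J : Ideal R} {a : R} (ha : a * a - a ∈ J) :
    ∃ e, IsIdempotentElem e ∧ e - a ∈ J := by
  obtain ⟨n, y, hy⟩ := IsArtinian.exists_pow_succ_smul_dvd a (1 : R)
  have pow_mul_pow (m : ℕ) : a ^ n * (a * y) ^ m = a ^ n := by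
    induction m with
    | zero => rw [pow_zero, mul_one]
    | succ m ih =>
      rw [pow_succ, ← mul_assoc, ih]
      simpa [pow_succ, mul_assoc] using hy
  refine ⟨(a * y) ^ (n + 1), ?_, ?_⟩
  · calc (a * y) ^ (n + 1) * (a * y) ^ (n + 1)
        = a ^ n * (a * y) ^ (n + 1) * (a * y ^ (n + 1)) := by ring
      _ = (a * y) ^ (n + 1) := by rw [pow_mul_pow]; ring
  · have idem : IsIdempotentElem (Ideal.Quotient.mk J a) := by
      rw [IsIdempotentElem, ← map_mul]
      exact Ideal.Quotient.eq.2 ha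
    have mk_mul : Ideal.Quotient.mk J (a * y) = Ideal.Quotient.mk J a := by
      have := congrArg (fun x => Ideal.Quotient.mk J (a * x)) (pow_mul_pow 1)
      simpa only [pow_one, ← mul_assoc, ← pow_succ', map_mul, map_pow, idem.pow_succ_eq, idem.eq]
        using this
    refine Ideal.Quotient.eq.1 ?_
    rw [map_pow, mk_mul, idem.pow_succ_eq]

lemma exists_isIdempotentElem_sub_mem (k : Type*) {A : Type*} [Field k] [Ring A] [Algebra k A]
    [Module.Finite k A] {I : Ideal A} {a : A} (ha : a * a - a ∈ I) :
    ∃ e, IsIdempotentElem e ∧ e - a ∈ I := by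
  let R := Algebra.adjoin k {a}
  have : IsArtinianRing R := IsArtinianRing.of_finite k R
  let a' : R := ⟨a, Algebra.self_mem_adjoin_singleton k a⟩
  obtain ⟨e, he, hea⟩ := exists_isIdempotentElem_sub_mem_of_isArtinianRing
    (J := I.comap R.val) (a := a') ha
  exact ⟨e, he.map R.val, hea⟩

/-- The left ideal of the endomorphisms of `V` that vanish in the stable category. -/
def stableIdeal {A : Type*} [Category* A] [Preadditive A] [Limits.HasZeroObject A]
    [Limits.HasBinaryBiproducts A] (V : A) : Ideal (End V) where
  carrier := { f | ∃ (P : A) (_ : Projective P) (a : V ⟶ P) (b : P ⟶ V), f = a ≫ b }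
  zero_mem' := ⟨_, Projective.zero_projective, 0, 0, Limits.zero_comp.symm⟩
  add_mem' := by
    rintro f g ⟨P, hP, a, b, h⟩ ⟨Q, hQ, c, d, h'⟩
    exact ⟨P ⊞ Q, inferInstance, Limits.biprod.lift a c, Limits.biprod.desc b d, by
      rw [Limits.biprod.lift_desc, h, h']⟩
  smul_mem' f := by
    rintro g ⟨P, hP, a, b, h⟩
    exact ⟨P, hP, a, b ≫ f, by rw [smul_eq_mul, End.mul_def, h, Category.assoc]⟩

lemma sub_mem_stableIdeal_iff {A : Type*} [Category* A] [Preadditive A] [Limits.HasZeroObject A]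
    [Limits.HasBinaryBiproducts A] {V : A} (f g : End V) :
    f - g ∈ stableIdeal V ↔ (toStable A).map (f : V ⟶ V) = (toStable A).map (g : V ⟶ V) :=
  (toStable_map_eq_iff (A := A) (X := V) (Y := V) f g).symm

lemma exists_split_of_stable_idempotent (k : Type*) [Field k] {A : Type*} [Category* A]
    [Preadditive A] [Linear k A] [Limits.HasZeroObject A] [Limits.HasBinaryBiproducts A]
    [IsIdempotentComplete A] {V : A} [Module.Finite k (V ⟶ V)] (a : V ⟶ V)
    (ha : (toStable A).map (a ≫ a) = (toStable A).map a) :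
    ∃ (Y : A) (i : Y ⟶ V) (r : V ⟶ Y), i ≫ r = 𝟙 Y ∧
      (toStable A).map (r ≫ i) = (toStable A).map a := by
  have : Module.Finite k (End V) := ‹Module.Finite k (V ⟶ V)›
  obtain ⟨e, he, hea⟩ := exists_isIdempotentElem_sub_mem k (A := End V) (a := a)
    ((sub_mem_stableIdeal_iff _ _).2 ha)
  obtain ⟨Y, i, r, hir, hri⟩ := IsIdempotentComplete.idempotents_split V e he
  exact ⟨Y, i, r, hir, hri ▸ (sub_mem_stableIdeal_iff _ _).1 hea⟩

end Idempotents

/-! ### Finite-dimensional representations -/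

section FinVal

variable {k : Type u} [Field k] {C : Type w} [Groupoid.{v} C]

variable (k) in
/-- The representations of a groupoid with finite-dimensional values. -/
def FinVal (V : Rp k C) : Prop := ∀ c, Module.Finite k (V.obj c)

lemma FinVal.of_retract {V W : Rp k C} (h : FinVal k V) (i : W ⟶ V) (r : V ⟶ W)
    (hir : i ≫ r = 𝟙 W) : FinVal k W := fun c => by
  have := h c
  exact Module.Finite.of_surjective (r.app c).hom fun x =>
    ⟨i.app c x, ConcreteCategory.congr_hom (NatTrans.congr_app hir c) x⟩

lemma FinVal.finite_hom [Finite C] {V W : Rp k C} (hV : FinVal k V) (hW : FinVal k W) :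
    Module.Finite k (V ⟶ W) := by
  have (c : C) : Module.Finite k (V.obj c) := hV c
  have (c : C) : Module.Finite k (W.obj c) := hW c
  let components : (V ⟶ W) →ₗ[k] ∀ c, V.obj c →ₗ[k] W.obj c :=
    { toFun f c := (f.app c).hom
      map_add' _ _ := rfl
      map_smul' _ _ := rfl }
  have : IsNoetherian k (∀ c, V.obj c →ₗ[k] W.obj c) := isNoetherian_pi
  exact Module.Finite.of_injective components fun f g h =>
    NatTrans.ext (funext fun c => ModuleCat.hom_ext (congrFun h c))

lemma FinVal.exists_split [Finite C] {V : Rp k C} (hV : FinVal k V) (a : V ⟶ V)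
    (ha : (toStable (Rp k C)).map (a ≫ a) = (toStable (Rp k C)).map a) :
    ∃ (Y : Rp k C) (i : Y ⟶ V) (r : V ⟶ Y), FinVal k Y ∧ i ≫ r = 𝟙 Y ∧
      (toStable (Rp k C)).map (r ≫ i) = (toStable (Rp k C)).map a := by
  have := hV.finite_hom hV
  obtain ⟨Y, i, r, hir, hri⟩ := exists_split_of_stable_idempotent k a ha
  exact ⟨Y, i, r, hV.of_retract i r hir, hir, hri⟩

end FinVal

section FiniteInvertible

lemma exists_lift_of_mono_app {C D : Type*} [Category* C] [Category* D] {X Y Z : C ⥤ D}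
    (j : X ⟶ Y) [∀ c, Mono (j.app c)] (f : Z ⟶ Y)
    (h : ∀ c, ∃ g : Z.obj c ⟶ X.obj c, g ≫ j.app c = f.app c) : ∃ g : Z ⟶ X, g ≫ j = f := by
  choose g hg using h
  refine ⟨⟨g, fun c d a => ?_⟩, NatTrans.ext (funext hg)⟩
  rw [← cancel_mono (j.app d), Category.assoc, hg, Category.assoc, j.naturality, reassoc_of% hg c,
    f.naturality]

lemma exists_retract_of_factorization {A : Type*} [Category* A] [MonoidalCategory A] {V V' V₀ : A}
    (e : 𝟙_ A ≅ V ⊗ V') (f : V' ⊗ V ≅ 𝟙_ A) (i : V₀ ⟶ V) (a : 𝟙_ A ⟶ V₀ ⊗ V')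
    (h : a ≫ i ▷ V' = e.hom) : ∃ (s : V ⟶ V₀) (r : V₀ ⟶ V), s ≫ r = 𝟙 V := by
  let u : V ≅ V := (λ_ V).symm ≪≫ whiskerRightIso e V ≪≫ α_ _ _ _ ≪≫ whiskerLeftIso V f ≪≫ ρ_ V
  refine ⟨(λ_ V).inv ≫ a ▷ V ≫ (α_ _ _ _).hom ≫ V₀ ◁ f.hom ≫ (ρ_ V₀).hom, i ≫ u.inv, ?_⟩
  rw [← Category.assoc, Iso.comp_inv_eq, Category.id_comp]
  simp only [u, Iso.trans_hom, Iso.symm_hom, whiskerRightIso_hom, whiskerLeftIso_hom, ← h,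
    comp_whiskerRight, Category.assoc, associator_naturality_left_assoc]
  rw [← rightUnitor_naturality, ← whisker_exchange_assoc]

variable {k : Type u} [Field k] {C : Type w} [Groupoid.{v} C]

/-- The subrepresentation given by a stable family of subspaces. -/
def subRep (V : Rp k C) (P : ∀ c, Submodule k (V.obj c))
    (hP : ∀ ⦃c d⦄ (f : c ⟶ d), P c ≤ (P d).comap (V.map f).hom) : Rp k C where
  obj c := ModuleCat.of k (P c)
  map f := ModuleCat.ofHom ((V.map f).hom.restrict (hP f))
  map_id c := ModuleCat.hom_ext (LinearMap.ext fun x => Subtype.ext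
    (ConcreteCategory.congr_hom (V.map_id c) x.val))
  map_comp f g := ModuleCat.hom_ext (LinearMap.ext fun x => Subtype.ext
    (ConcreteCategory.congr_hom (V.map_comp f g) x.val))

/-- The inclusion of a subrepresentation. -/
def subRepι (V : Rp k C) (P : ∀ c, Submodule k (V.obj c))
    (hP : ∀ ⦃c d⦄ (f : c ⟶ d), P c ≤ (P d).comap (V.map f).hom) : subRep V P hP ⟶ V where
  app c := ModuleCat.ofHom (P c).subtype

lemma exists_stable_submodule [Finite C] [∀ c d : C, Finite (c ⟶ d)] (V : Rp k C)
    (P : ∀ c, Submodule k (V.obj c)) (hP : ∀ c, (P c).FG) :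
    ∃ Q : ∀ c, Submodule k (V.obj c), (∀ c, P c ≤ Q c) ∧ (∀ c, (Q c).FG) ∧
      ∀ ⦃c d⦄ (f : c ⟶ d), Q c ≤ (Q d).comap (V.map f).hom := by
  refine ⟨fun d => ⨆ (c) (f : c ⟶ d), (P c).map (V.map f).hom, fun c => ?_,
    fun d => Submodule.fg_iSup _ fun c => Submodule.fg_iSup _ fun f => (hP c).map _,
    fun c d g => iSup₂_le fun b f => ?_⟩
  · refine le_iSup₂_of_le c (𝟙 c) ?_
    rw [V.map_id, ModuleCat.hom_id, Submodule.map_id]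
  · rw [← Submodule.map_le_iff_le_comap, ← Submodule.map_comp, ← ModuleCat.hom_comp,
      ← V.map_comp]
    exact le_iSup₂_of_le b (f ≫ g) le_rfl

lemma exists_factorization_through_finVal [Finite C] [∀ c d : C, Finite (c ⟶ d)]
    {V V' : Rp k C} (a : 𝟙_ (Rp k C) ⟶ V ⊗ V') :
    ∃ (V₀ : Rp k C) (i : V₀ ⟶ V) (a₀ : 𝟙_ _ ⟶ V₀ ⊗ V'), FinVal k V₀ ∧ a₀ ≫ i ▷ V' = a := by
  let t (c : C) : TensorProduct k (V.obj c) (V'.obj c) := (a.app c).hom (1 : k)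
  choose P hP ht using fun c =>
    TensorProduct.exists_finite_submodule_left_of_setFinite {t c} (Set.finite_singleton _)
  obtain ⟨Q, hPQ, hQ, hs⟩ := exists_stable_submodule V P fun c => Module.Finite.iff_fg.1 (hP c)
  have (c : C) : Mono ((subRepι V Q hs ▷ V').app c) :=
    (ModuleCat.mono_iff_injective _).2
      (Module.Flat.rTensor_preserves_injective_linearMap (Q c).subtype (Q c).subtype_injective)
  obtain ⟨a₀, ha₀⟩ := exists_lift_of_mono_app (subRepι V Q hs ▷ V') a fun c => by
    obtain ⟨t₀, ht₀⟩ : t c ∈ LinearMap.range ((Q c).subtype.rTensor (V'.obj c)) := by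
      obtain ⟨y, hy⟩ := ht c rfl
      refine ⟨(Submodule.inclusion (hPQ c)).rTensor _ y, ?_⟩
      rw [← hy, ← LinearMap.comp_apply, ← LinearMap.rTensor_comp, Submodule.subtype_comp_inclusion]
    refine ⟨ModuleCat.ofHom (LinearMap.toSpanSingleton k _ t₀),
      ModuleCat.hom_ext (LinearMap.ext_ring (Eq.trans ?_ ht₀))⟩
    exact congrArg ((Q c).subtype.rTensor _) (one_smul k t₀)
  exact ⟨subRep V Q hs, subRepι V Q hs, a₀, fun c => Module.Finite.iff_fg.2 (hQ c), ha₀⟩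

lemma exists_finVal_of_tensorInvertible [Finite C] [∀ c d : C, Finite (c ⟶ d)] {V : StRp k C}
    (hV : TensorInvertible V) :
    ∃ Y : Rp k C, FinVal k Y ∧ Nonempty (V ≅ (toStable _).obj Y) := by
  obtain ⟨V', ⟨e⟩, ⟨f⟩⟩ := hV
  obtain ⟨a, ha⟩ := (toStable (Rp k C)).map_surjective (X := 𝟙_ _) (Y := V.as ⊗ V'.as) e.inv
  obtain ⟨V₀, i, a₀, hV₀, h⟩ := exists_factorization_through_finVal a
  obtain ⟨s, r, hsr⟩ := exists_retract_of_factorization e.symm f ((toStable _).map i)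
    ((toStable _).map a₀) ((congrArg (toStable _).map h).trans ha)
  obtain ⟨b, hb⟩ := (toStable (Rp k C)).map_surjective (X := V₀) (Y := V₀) (r ≫ s)
  obtain ⟨Y, j, q, hY, hjq, hqj⟩ := hV₀.exists_split b (by
    rw [Functor.map_comp, hb, Category.assoc, reassoc_of% hsr])
  replace hjq := congrArg (toStable _).map hjq
  rw [Functor.map_comp, CategoryTheory.Functor.map_id] at hjq
  rw [Functor.map_comp, hb] at hqj
  refine ⟨Y, hY, ⟨⟨s ≫ (toStable _).map q, (toStable _).map j ≫ r, ?_, ?_⟩⟩⟩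
  · rw [Category.assoc, reassoc_of% hqj, hsr, Category.comp_id, hsr]
  · rw [Category.assoc, ← Category.assoc r, ← hqj, Category.assoc, hjq, Category.comp_id, hjq]

end FiniteInvertible

/-! ### Duals -/

section Duals

variable {k : Type u} [Field k] {C : Type w} [Groupoid.{v} C]

lemma FinVal.exists_exactPairing {V : Rp k C} (hV : FinVal k V) :
    ∃ V' : Rp k C, Nonempty (ExactPairing V V') := by
  let W : C ⥤ FGModuleCat.{u} k := (ModuleCat.isFG k).lift V hV
  let F : (C ⥤ FGModuleCat.{u} k) ⥤ Rp k C :=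
    (Functor.whiskeringRight C _ _).obj (ModuleCat.isFG k).ι
  exact ⟨F.obj Wᘁ, ⟨exactPairingMap F W Wᘁ⟩⟩

instance {A : Type*} [Category* A] [Preadditive A] [MonoidalCategory A] [MonoidalPreadditive A]
    [ProjectivesTensorIdeal A] : (toStable A).Monoidal :=
  Functor.CoreMonoidal.toMonoidal
    { εIso := Iso.refl _
      μIso X Y := Iso.refl _
      μIso_hom_natural_left f X := (Category.comp_id _).trans (Category.id_comp _).symm
      μIso_hom_natural_right X f := (Category.comp_id _).trans (Category.id_comp _).symm
      associativity := by intros; simp; rfl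
      left_unitality := by intros; simp; rfl
      right_unitality := by intros; simp; rfl }

lemma TensorInvertible.of_map {A B : Type*} [Category* A] [MonoidalCategory A]
    [BraidedCategory A] [Category* B] [MonoidalCategory B] (F : A ⥤ B) [F.Monoidal]
    [F.ReflectsIsomorphisms] {V : A} (V' : A) [ExactPairing V V']
    (h : TensorInvertible (F.obj V)) : TensorInvertible V := by
  let _ := exactPairingMap F V V'
  have : IsIso (ε_ (F.obj V) (F.obj V')) := h.isIso_evaluation
  have : F.map (ε_ V V') = Functor.OplaxMonoidal.δ F V' V ≫ ε_ (F.obj V) (F.obj V') ≫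
      Functor.LaxMonoidal.ε F := by
    change _ = Functor.OplaxMonoidal.δ F V' V ≫ (Functor.LaxMonoidal.μ F V' V ≫ F.map (ε_ V V') ≫
      Functor.OplaxMonoidal.η F) ≫ Functor.LaxMonoidal.ε F
    simp only [Category.assoc, Functor.Monoidal.δ_μ_assoc, Functor.Monoidal.η_ε, Category.comp_id]
  have : IsIso (F.map (ε_ V V')) := this ▸ inferInstance
  have : IsIso (ε_ V V') := isIso_of_reflects_iso _ F
  exact ⟨V', ⟨β_ V V' ≪≫ asIso (ε_ V V')⟩, ⟨asIso (ε_ V V')⟩⟩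

end Duals

/-! ### Endotrivial modules -/

section Endotrivial

variable (k : Type u) [Field k] (K : Type v) [Group K]

lemma EndoT.incl_val {t : EndoT k K} {V : FinStab k K} (h : t.val = toSkeleton V) :
    (EndoT.incl k K t).val = toSkeleton V.obj :=
  Pic.map_val _ h

lemma EndoT.incl_injective : Function.Injective (EndoT.incl k K) := by
  intro t t' h
  obtain ⟨V, hV⟩ := Pic.exists_rep t
  obtain ⟨V', hV'⟩ := Pic.exists_rep t'
  have skeleton_eq := congrArg Units.val h
  rw [EndoT.incl_val k K hV, EndoT.incl_val k K hV', toSkeleton_eq_toSkeleton_iff] at skeleton_eq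
  obtain ⟨e⟩ := skeleton_eq
  ext
  rw [hV, hV']
  exact congr_toSkeleton_of_iso ((finDim k K).isoMk e)

variable [Finite K]

lemma EndoT.incl_surjective : Function.Surjective (EndoT.incl k K) := by
  intro w
  obtain ⟨V, hV⟩ := Pic.exists_rep w
  obtain ⟨Y, hY, ⟨e⟩⟩ := exists_finVal_of_tensorInvertible (Pic.tensorInvertible hV)
  obtain ⟨V', ⟨f⟩, ⟨g⟩⟩ := Pic.tensorInvertible hV
  obtain ⟨Y', hY', ⟨e'⟩⟩ := exists_finVal_of_tensorInvertible (V := V') ⟨V, ⟨g⟩, ⟨f⟩⟩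
  let Z : FinStab k K := ⟨(toStable _).obj Y, hY (SingleObj.star K)⟩
  let Z' : FinStab k K := ⟨(toStable _).obj Y', hY' (SingleObj.star K)⟩
  have hZ : TensorInvertible Z := ⟨Z', ⟨(finDim k K).isoMk ((e.symm ⊗ᵢ e'.symm) ≪≫ f)⟩,
    ⟨(finDim k K).isoMk ((e'.symm ⊗ᵢ e.symm) ≪≫ g)⟩⟩
  obtain ⟨t, ht⟩ := isUnit_toSkeleton_iff.2 hZ
  refine ⟨t, Units.ext ?_⟩
  rw [EndoT.incl_val k K ht, hV]
  exact congr_toSkeleton_of_iso e.symm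

lemma EndoT.incl_bijective : Function.Bijective (EndoT.incl k K) :=
  ⟨EndoT.incl_injective k K, EndoT.incl_surjective k K⟩

lemma Pic.map_stRes_bijective {C D : Type*} [Groupoid C] [Groupoid D] [EssentiallySmall.{u} C]
    [EssentiallySmall.{u} D] [LocallySmall.{u} C] [LocallySmall.{u} D] (F : C ⥤ D)
    [F.IsEquivalence] : Function.Bijective (Pic.map (stRes k F)) :=
  Pic.map_bijective_of_inverse _ (stRes k F.inv)
    (fun V => ⟨(toStable _).mapIso (Functor.isoWhiskerRight F.asEquivalence.counitIso V.as)⟩)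
    (fun V => ⟨(toStable _).mapIso (Functor.isoWhiskerRight F.asEquivalence.unitIso.symm V.as)⟩)

variable {K} (H : Subgroup K)

instance : (orbitIncl H).IsEquivalence where
  full := ⟨fun {x y} a => by
    have fixes : a.val • ((1 : K) : K ⧸ H) = ((1 : K) : K ⧸ H) := a.property
    rw [MulAction.Quotient.smul_coe, QuotientGroup.eq] at fixes
    exact ⟨⟨a.val, by simpa using fixes⟩, rfl⟩⟩
  essSurj := ⟨fun ⟨x⟩ => by
    obtain ⟨g, rfl⟩ := QuotientGroup.mk_surjective x
    refine ⟨SingleObj.star H, ⟨(Groupoid.isoEquivHom _ _).symm ⟨g, ?_⟩⟩⟩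
    change g • ((1 : K) : K ⧸ H) = _
    rw [MulAction.Quotient.smul_coe, smul_eq_mul, mul_one]⟩

instance : Subsingleton (orbit (⊤ : Subgroup K)).carrier :=
  QuotientGroup.subsingleton_quotient_top

variable (K) in
/-- The functor from the one-object groupoid of a group to the action groupoid of a point. -/
def pointIncl : SingleObj K ⥤ ActionGroupoid (orbit (⊤ : Subgroup K)) where
  obj _ := ⟨((1 : K) : K ⧸ (⊤ : Subgroup K))⟩
  map g := ⟨g, Subsingleton.elim _ _⟩
  map_id _ := rfl
  map_comp _ _ := rfl

instance : (pointIncl K).IsEquivalence where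
  faithful := ⟨fun h => congrArg Subtype.val h⟩
  full := ⟨fun a => ⟨a.val, rfl⟩⟩
  essSurj := ⟨fun _ => ⟨SingleObj.star K,
    ⟨(Groupoid.isoEquivHom _ _).symm ⟨1, Subsingleton.elim _ _⟩⟩⟩⟩

lemma EndoT.incl_res (t : EndoT k K) :
    EndoT.incl k H (EndoT.res k H t) = Pic.map (stRes k (subIncl H)) (EndoT.incl k K t) := by
  obtain ⟨V, hV⟩ := Pic.exists_rep t
  ext
  exact (EndoT.incl_val k H (Pic.map_val (finRes k H) hV)).trans
    (Pic.map_val (stRes k (subIncl H)) (EndoT.incl_val k K hV)).symm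

lemma orbitPic_map_orbitProj (v : (stPic k K).obj (Opposite.op (orbit (⊤ : Subgroup K)))) :
    orbitPic k H (((stPic k K).map (orbitProj H).op).hom v) =
      Pic.map (stRes k (subIncl H)) (Pic.map (stRes k (pointIncl K)) v) := by
  obtain ⟨V, hV⟩ := Pic.exists_rep (show Pic (StRep k (orbit (⊤ : Subgroup K))) from v)
  ext
  exact (Pic.map_val (stRes k (orbitIncl H)) (Pic.map_val (pull k (orbitProj H)) hV)).trans
    (Pic.map_val (stRes k (subIncl H)) (Pic.map_val (stRes k (pointIncl K)) hV)).symm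

/-- The Picard group of the stable category of `K/H` is the group of endotrivial modules of `H`. -/
noncomputable def orbitPicEquiv : (stPic k K).obj (Opposite.op (orbit H)) ≃* EndoT k H :=
  (MulEquiv.ofBijective _ (Pic.map_stRes_bijective k (orbitIncl H))).trans
    (MulEquiv.ofBijective _ (EndoT.incl_bijective k H)).symm

lemma incl_orbitPicEquiv (w : (stPic k K).obj (Opposite.op (orbit H))) :
    EndoT.incl k H (orbitPicEquiv k H w) = orbitPic k H w :=
  (MulEquiv.ofBijective _ (EndoT.incl_bijective k H)).apply_symm_apply _

lemma map_range_orbitPicEquiv :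
    ((stPic k K).map (orbitProj H).op).hom.range.map (orbitPicEquiv k H).toMonoidHom =
      (EndoT.res k H).range := by
  have equiv_eq_res_iff (v t) : orbitPicEquiv k H (((stPic k K).map (orbitProj H).op).hom v) =
      EndoT.res k H t ↔ Pic.map (stRes k (subIncl H)) (Pic.map (stRes k (pointIncl K)) v) =
        Pic.map (stRes k (subIncl H)) (EndoT.incl k K t) := by
    rw [← (EndoT.incl_bijective k H).1.eq_iff, incl_orbitPicEquiv, orbitPic_map_orbitProj,
      EndoT.incl_res]
  ext t
  constructor
  · rintro ⟨_, ⟨v, rfl⟩, rfl⟩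
    obtain ⟨s, hs⟩ := (EndoT.incl_bijective k K).2 (Pic.map (stRes k (pointIncl K)) v)
    exact ⟨s, ((equiv_eq_res_iff v s).2 (by rw [hs])).symm⟩
  · rintro ⟨s, rfl⟩
    obtain ⟨v, hv⟩ := (Pic.map_stRes_bijective k (pointIncl K)).2 (EndoT.incl k K s)
    exact ⟨_, ⟨v, rfl⟩, (equiv_eq_res_iff v s).2 (by rw [← hv])⟩

end Endotrivial

/-! ### The coaction defined by a morphism over the fibre square -/

section Coaction

variable {k : Type u} [Field k] {G : Type v} [Group G] {U X : FinGSet.{v} G} {α : U ⟶ X}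

/-- The point of the fibre square given by a point and an element of its fibre. -/
def fibPair (u : ActionGroupoid U) (y : Fib α ((actionMap α).obj u)) :
    ActionGroupoid (fiberPower α 1) :=
  ⟨![u.pt, y.val.pt], by
    have hy := congrArg ActionGroupoid.pt y.property
    dsimp [actionMap] at hy
    intro i j; fin_cases i <;> fin_cases j <;> simp [hy]⟩

/-- The point of the triple fibre power given by a point and two elements of its fibre. -/
def fibTriple (u : ActionGroupoid U) (y : Fib α ((actionMap α).obj u))
    (z : Fib α ((actionMap α).obj y.val)) : ActionGroupoid (fiberPower α 2) :=
  ⟨![u.pt, y.val.pt, z.val.pt], by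
    have hy := congrArg ActionGroupoid.pt y.property
    have hz := congrArg ActionGroupoid.pt z.property
    dsimp [actionMap] at hy hz
    intro i j; fin_cases i <;> fin_cases j <;> simp [hy, hz]⟩

section Arrows

variable {u u' : ActionGroupoid U} (a : u ⟶ u') {y : Fib α ((actionMap α).obj u)}
  {y' : Fib α ((actionMap α).obj u')} (b : y.val ⟶ y'.val) (hb : b.val = a.val)

/-- The arrow of the fibre square with the given components. -/
def fibPairHom : fibPair u y ⟶ fibPair u' y' :=
  ⟨a.val, Subtype.ext <| funext fun i => by
    fin_cases i
    exacts [a.property, hb ▸ b.property]⟩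

/-- The arrow of the triple fibre power with the given components. -/
def fibTripleHom {z : Fib α ((actionMap α).obj y.val)} {z' : Fib α ((actionMap α).obj y'.val)}
    (c : z.val ⟶ z'.val) (hc : c.val = b.val) : fibTriple u y z ⟶ fibTriple u' y' z' :=
  ⟨a.val, Subtype.ext <| funext fun i => by
    fin_cases i
    exacts [a.property, hb ▸ b.property, (hc.trans hb) ▸ c.property]⟩

end Arrows

variable {W : Rp k (ActionGroupoid U)}

/-- The coaction whose components are those of a morphism over the fibre square. -/
noncomputable def coact
    (x : (res k (factor α (0 : Fin 2))).obj W ⟶ (res k (factor α (1 : Fin 2))).obj W) :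
    W ⟶ actionMap α ⋙ (push α).obj W :=
  pushHom α (actionMap α) (fun u y => x.app (fibPair u y)) fun a _ _ b h =>
    (x.naturality (fibPairHom a b h)).trans <|
      congrArg (_ ≫ W.map ·) (Subtype.ext h.symm)

variable (W) in
/-- The projection of the pushforward of the triple fibre power onto one summand. -/
noncomputable def tripleπ {u : ActionGroupoid U} (y : Fib α ((actionMap α).obj u))
    (z : Fib α ((actionMap α).obj y.val)) :
    ((push (factor α (0 : Fin 3))).obj (actionMap (factor α (2 : Fin 3)) ⋙ W)).obj u ⟶
      W.obj z.val :=
  pushπ (actionMap (factor α (2 : Fin 3)) ⋙ W) ⟨fibTriple u y z, rfl⟩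

variable (α W) in
/-- The comparison from the pushforward of the triple fibre power to the iterated pushforward. -/
noncomputable def tripleComparison :
    (push (factor α (0 : Fin 3))).obj (actionMap (factor α (2 : Fin 3)) ⋙ W) ⟶
      actionMap α ⋙ (push α).obj (actionMap α ⋙ (push α).obj W) :=
  pushHom α (actionMap α) (W := actionMap α ⋙ (push α).obj W)
    (fun _ y => pushLift W fun z => tripleπ W y z)
    fun a y y' b h => push_hom_ext fun z' => by
      rw [Category.assoc, pushLift_π, Category.assoc, Functor.comp_map,
        push_obj_map_π W _ (z'.lift_val ((actionMap α).map b)), reassoc_of% pushLift_π W]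
      exact (push_obj_map_π (actionMap (factor α (2 : Fin 3)) ⋙ W) a
        (b := fibTripleHom a b h (z'.lift ((actionMap α).map b)) rfl) rfl).trans <|
          congrArg (_ ≫ W.map ·) (Subtype.ext (by exact h.symm))

/-- The morphism to the iterated pushforward whose components are those of a morphism over the
triple fibre power. It is written as a composite to make it compatible with stable equality. -/
noncomputable def tripleCoact
    (f : (res k (factor α (0 : Fin 3))).obj W ⟶ (res k (factor α (2 : Fin 3))).obj W) :
    W ⟶ actionMap α ⋙ (push α).obj (actionMap α ⋙ (push α).obj W) :=
  toPush (factor α (0 : Fin 3)) W ≫ (push (factor α (0 : Fin 3))).map f ≫ tripleComparison α W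

lemma toPush_map_π {Y Z : FinGSet.{v} G} {p : Z ⟶ Y} {V : Rp k (ActionGroupoid Y)}
    {W : Rp k (ActionGroupoid Z)} (f : actionMap p ⋙ V ⟶ W) (z : ActionGroupoid Z) :
    (toPush p V).app _ ≫ ((push p).map f).app _ ≫ pushπ W ⟨z, rfl⟩ = f.app z := by
  rw [push_map_π, reassoc_of% toPush_π V, fibIso_self]
  exact Category.id_comp _

lemma tripleCoact_π
    (f : (res k (factor α (0 : Fin 3))).obj W ⟶ (res k (factor α (2 : Fin 3))).obj W)
    (u : ActionGroupoid U) (y : Fib α ((actionMap α).obj u))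
    (z : Fib α ((actionMap α).obj y.val)) :
    (tripleCoact f).app u ≫ pushπ (actionMap α ⋙ (push α).obj W) y ≫ pushπ W z =
      f.app (fibTriple u y z) := by
  have comparison_π : (tripleComparison α W).app u ≫
      pushπ (actionMap α ⋙ (push α).obj W) y ≫ pushπ W z = tripleπ W y z := by
    rw [tripleComparison,
      reassoc_of% pushHom_π (p := α) (actionMap α) (W := actionMap α ⋙ (push α).obj W), pushLift_π]
  rw [tripleCoact, NatTrans.comp_app, NatTrans.comp_app, Category.assoc, Category.assoc,
    comparison_π]
  exact toPush_map_π f (fibTriple u y z)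

/-- The pullback to the triple fibre power, along the projection on two factors, of a morphism
over the fibre square. -/
def pullHom (x : (res k (factor α (0 : Fin 2))).obj W ⟶ (res k (factor α (1 : Fin 2))).obj W)
    (i j : Fin 3) : (res k (factor α i)).obj W ⟶ (res k (factor α j)).obj W :=
  (res k (fiberProj α ![i, j])).map x

variable (x : (res k (factor α (0 : Fin 2))).obj W ⟶ (res k (factor α (1 : Fin 2))).obj W)

section Components

variable (u : ActionGroupoid U) (y : Fib α ((actionMap α).obj u))

lemma coact_π : (coact x).app u ≫ pushπ W y = x.app (fibPair u y) :=
  pushHom_π (actionMap α) _ _ u y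

variable (z : Fib α ((actionMap α).obj y.val))

lemma pullHom_zero_one_app :
    (pullHom x 0 1).app (fibTriple u y z) = x.app (fibPair u y) := by
  have proj : (actionMap (fiberProj α ![0, 1])).obj (fibTriple u y z) = fibPair u y :=
    ActionGroupoid.ext <| Subtype.ext <| funext fun i => by fin_cases i <;> rfl
  exact eq_of_heq (congr_arg_heq x.app proj)

lemma pullHom_one_two_app :
    (pullHom x 1 2).app (fibTriple u y z) = x.app (fibPair y.val z) := by
  have proj : (actionMap (fiberProj α ![1, 2])).obj (fibTriple u y z) = fibPair y.val z :=
    ActionGroupoid.ext <| Subtype.ext <| funext fun i => by fin_cases i <;> rfl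
  exact eq_of_heq (congr_arg_heq x.app proj)

lemma pullHom_zero_two_app :
    (pullHom x 0 2).app (fibTriple u y z) =
      x.app (fibPair u ⟨z.val, z.property.trans y.property⟩) := by
  have proj : (actionMap (fiberProj α ![0, 2])).obj (fibTriple u y z) =
      fibPair u ⟨z.val, z.property.trans y.property⟩ :=
    ActionGroupoid.ext <| Subtype.ext <| funext fun i => by fin_cases i <;> rfl
  exact eq_of_heq (congr_arg_heq x.app proj)

end Components

lemma coact_comp_map :
    coact x ≫ (res k α).map ((push α).map (coact x)) =
      tripleCoact (pullHom x 0 1 ≫ pullHom x 1 2) := by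
  ext u : 2
  refine push_hom_ext (W := actionMap α ⋙ (push α).obj W) fun y => push_hom_ext fun z => ?_
  have push_coact_π := push_map_π (coact x) y
  have triple_π := tripleCoact_π (pullHom x 0 1 ≫ pullHom x 1 2) u y z
  dsimp at push_coact_π triple_π ⊢
  simp only [Category.assoc]
  rw [reassoc_of% push_coact_π, reassoc_of% coact_π x u y, coact_π x y.val z, triple_π]
  exact congrArg₂ (· ≫ ·) (pullHom_zero_one_app x u y z).symm (pullHom_one_two_app x u y z).symm

lemma coact_comp_toPush :
    coact x ≫ (res k α).map (toPush α ((push α).obj W)) = tripleCoact (pullHom x 0 2) := by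
  ext u : 2
  refine push_hom_ext (W := actionMap α ⋙ (push α).obj W) fun y => push_hom_ext fun z => ?_
  have triple_π := tripleCoact_π (pullHom x 0 2) u y z
  dsimp at triple_π ⊢
  simp only [Category.assoc]
  rw [triple_π, pullHom_zero_two_app, reassoc_of% toPush_π ((push α).obj W) y, fibIso_inv_π]
  exact coact_π x u _

variable (α) in
/-- The diagonal of a fibre power. -/
def diag (n : ℕ) : U ⟶ fiberPower α n :=
  show U.carrier →[G] (fiberPower α n).carrier from
  { toFun u := ⟨fun _ => u, fun _ _ => rfl⟩
    map_smul' _ _ := rfl }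

/-- The restriction to the diagonal of a morphism over the fibre square. -/
def diagHom : W ⟶ W := (res k (diag α 1)).map x

lemma coact_comp_counit : coact x ≫ (resPushAdj α).counit.app W = diagHom x := by
  ext u : 2
  have diag_eq : fibPair u ⟨u, rfl⟩ = (actionMap (diag α 1)).obj u :=
    ActionGroupoid.ext <| Subtype.ext <| funext fun i => by fin_cases i <;> rfl
  exact (coact_π x u ⟨u, rfl⟩).trans (eq_of_heq (congr_arg_heq x.app diag_eq))

end Coaction

/-! ### Effective descent -/

section EffectiveDescent

variable {k : Type u} [Field k] {G : Type v} [Group G] {U X : FinGSet.{v} G} {α : U ⟶ X}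

lemma FinVal.push_obj {W : Rp k (ActionGroupoid U)} (hW : FinVal k W) :
    FinVal k ((push α).obj W) := fun x => by
  have (c : ActionGroupoid U) : Module.Finite k (W.obj c) := hW c
  let components : ((push α).obj W).obj x →ₗ[k] ∀ y : Fib α x, W.obj y.val :=
    LinearMap.pi fun y => (pushπ W y).hom
  have : IsNoetherian k (∀ y : Fib α x, W.obj y.val) := isNoetherian_pi
  exact Module.Finite.of_injective components fun a b h =>
    Limits.Concrete.isLimit_ext _ (Limits.biproduct.isLimit fun y : Fib α x => W.obj y.val) a b
      fun y => congrFun h y.as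

section Stable

variable {W : Rp k (ActionGroupoid U)}

lemma toStable_map_tripleCoact
    {f g : (res k (factor α (0 : Fin 3))).obj W ⟶ (res k (factor α (2 : Fin 3))).obj W}
    (h : (toStable _).map f = (toStable _).map g) :
    (toStable _).map (tripleCoact f) = (toStable _).map (tripleCoact g) := by
  have push_eq : (toStable _).map ((push (k := k) (factor α (0 : Fin 3))).map f) =
      (toStable _).map ((push (k := k) (factor α (0 : Fin 3))).map g) :=
    congrArg (stableMap (push (k := k) (factor α (0 : Fin 3)))).map h
  simp only [tripleCoact, Functor.map_comp, push_eq]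

variable [Finite G]
  {x : (res k (factor α (0 : Fin 2))).obj W ⟶ (res k (factor α (1 : Fin 2))).obj W}

lemma Gluing.pullTo_inv {ξ : Gluing k α ((toStable _).obj W)} (hx : (toStable _).map x = ξ.inv)
    (i j : Fin 3) : (ξ.pullTo i j).inv = (toStable _).map (pullHom x i j) := by
  have pull_inv : (pull k (fiberProj α ![i, j])).map ξ.inv = (toStable _).map (pullHom x i j) := by
    rw [← hx]
    rfl
  exact (Category.id_comp _).trans ((Category.comp_id _).trans pull_inv)

-- The pullback of a cocycle to the diagonal is an idempotent isomorphism.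
lemma toStable_map_diagHom {ξ : Gluing k α ((toStable _).obj W)}
    (hx : (toStable _).map x = ξ.inv)
    (h : (toStable _).map (pullHom x 0 1 ≫ pullHom x 1 2) = (toStable _).map (pullHom x 0 2)) :
    (toStable _).map (diagHom x) = 𝟙 ((toStable _).obj W) := by
  have idem : (toStable _).map (diagHom x) ≫ (toStable _).map (diagHom x) =
      (toStable _).map (diagHom x) := congrArg (pull k (diag α 2)).map h
  have : IsIso ((toStable _).map (diagHom x)) := by
    have pull_inv : (toStable _).map (diagHom x) = (pull k (diag α 1)).map ξ.inv := by
      rw [← hx]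
      rfl
    rw [pull_inv]
    exact inferInstanceAs (IsIso ((pull k (diag α 1)).map ξ.inv))
  exact (cancel_epi ((toStable _).map (diagHom x))).1 (idem.trans (Category.comp_id _).symm)

lemma isCoaction_coact {ξ : Gluing k α ((toStable _).obj W)} (hx : (toStable _).map x = ξ.inv)
    (hξ : ξ.defect = Iso.refl _) :
    IsCoaction (stableAdj (resPushAdj (k := k) α)) ((toStable _).map (coact x)) := by
  have cocycle : (toStable _).map (pullHom x 0 1 ≫ pullHom x 1 2) =
      (toStable _).map (pullHom x 0 2) := by
    rw [Functor.map_comp, ← ξ.pullTo_inv hx, ← ξ.pullTo_inv hx, ← ξ.pullTo_inv hx,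
      ← cancel_epi (ξ.pullTo 0 2).hom, Iso.hom_inv_id]
    simpa [Gluing.defect] using congrArg Iso.inv hξ
  exact
    { coassoc := (congrArg (toStable _).map (coact_comp_map x)).trans <|
        (toStable_map_tripleCoact cocycle).trans
          (congrArg (toStable _).map (coact_comp_toPush x)).symm
      counit := (congrArg (toStable _).map (coact_comp_counit x)).trans
        (toStable_map_diagHom hx cocycle) }

end Stable

variable [Finite G]

lemma unit_stableAdj_averagedTrace (hα : ∀ x : ActionGroupoid X, (Nat.card (Fib α x) : k) ≠ 0)
    (V : StRep k X) :
    (stableAdj (resPushAdj α)).unit.app V ≫ (stableToId (averagedTrace α)).app V = 𝟙 V :=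
  congrArg (toStable _).map (toPush_averagedTrace α hα V.as)

lemma exists_descent (hα : ∀ x : ActionGroupoid X, (Nat.card (Fib α x) : k) ≠ 0)
    {W : Rp k (ActionGroupoid U)} (hW : FinVal k W)
    (ξ : Gluing k α ((toStable _).obj W)) (hξ : ξ.defect = Iso.refl _) :
    ∃ V : Rp k (ActionGroupoid X), FinVal k V ∧
      Nonempty ((pull k α).obj ((toStable _).obj V) ≅ (toStable _).obj W) := by
  obtain ⟨x, hx⟩ := (toStable _).map_surjective
    (X := (res k (factor α (0 : Fin 2))).obj W) (Y := (res k (factor α (1 : Fin 2))).obj W) ξ.inv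
  have hρ := isCoaction_coact hx hξ
  have hs := unit_stableAdj_averagedTrace hα
  obtain ⟨e, he⟩ := (toStable _).map_surjective (X := (push α).obj W) (Y := (push α).obj W)
    (averaging (stableToId (averagedTrace α)) ((toStable _).map (coact x)))
  obtain ⟨V, i, r, hV, hir, hri⟩ := hW.push_obj.exists_split e (by
    rw [Functor.map_comp, he]
    exact averaging_idem hs hρ)
  refine ⟨V, hV, hρ.nonempty_iso_of_split hs ((toStable _).map r) ((toStable _).map i)
    (congrArg (toStable _).map hir) ?_⟩
  rw [← Functor.map_comp, hri, he]

lemma pull_reflectsIsomorphisms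
    (hα : ∀ x : ActionGroupoid X, (Nat.card (Fib α x) : k) ≠ 0) :
    (pull k α).ReflectsIsomorphisms where
  reflects f _ := isIso_of_isIso_map_of_retraction (unit_stableAdj_averagedTrace hα) f

lemma FinVal.tensorInvertible_of_pull
    (hα : ∀ x : ActionGroupoid X, (Nat.card (Fib α x) : k) ≠ 0)
    {V : Rp k (ActionGroupoid X)} (hV : FinVal k V)
    (h : TensorInvertible ((pull k α).obj ((toStable _).obj V))) :
    TensorInvertible ((toStable _).obj V) := by
  obtain ⟨V', ⟨hV'⟩⟩ := hV.exists_exactPairing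
  have := pull_reflectsIsomorphisms hα
  have := exactPairingMap (toStable _) V V'
  exact .of_map (pull k α) ((toStable _).obj V') h

end EffectiveDescent

/-! ### Čech cochains -/

section Cech

variable {G : Type v} [Group G] {U X : FinGSet.{v} G} (P : (FinGSet.{v} G)ᵒᵖ ⥤ CommGrpCat.{w})
  (α : U ⟶ X)

lemma mem_cechH0_iff {c : P.obj (Opposite.op U)} : c ∈ cechH0 P α ↔
    (P.map (factor α (0 : Fin 2)).op).hom c = (P.map (factor α (1 : Fin 2)).op).hom c := by
  rw [cechH0, MonoidHom.mem_ker, MonoidHom.div_apply, div_eq_one]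

lemma factor_comp (n : ℕ) (i j : Fin (n + 1)) : factor α i ≫ α = factor α j ≫ α :=
  MulActionHom.ext fun u => u.property i j

lemma map_mem_cechH0 (c : P.obj (Opposite.op X)) : (P.map α.op).hom c ∈ cechH0 P α := by
  rw [mem_cechH0_iff]
  have map_comp_eq : P.map α.op ≫ P.map (factor α (0 : Fin 2)).op =
      P.map α.op ≫ P.map (factor α (1 : Fin 2)).op := by
    rw [← P.map_comp, ← P.map_comp, ← op_comp, ← op_comp, factor_comp α 1 0 1]
  exact ConcreteCategory.congr_hom map_comp_eq c

lemma cechD_apply (n : ℕ) (c : CechCochain P α n) :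
    cechD P α n c = ∏ i : Fin (n + 2),
      ((P.map (fiberProj α i.succAbove).op).hom c) ^ ((-1 : ℤ) ^ (i : ℕ)) := by
  rw [cechD, MonoidHom.finsetProd_apply]
  rfl

lemma cechD_one_apply (c : CechCochain P α 1) :
    cechD P α 1 c = (P.map (fiberProj α ![1, 2]).op).hom c *
      ((P.map (fiberProj α ![0, 2]).op).hom c)⁻¹ *
      (P.map (fiberProj α ![0, 1]).op).hom c := by
  have succAbove_zero : (0 : Fin 3).succAbove = ![1, 2] := by decide
  have succAbove_one : (1 : Fin 3).succAbove = ![0, 2] := by decide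
  have succAbove_two : (2 : Fin 3).succAbove = ![0, 1] := by decide
  simp [cechD_apply, Fin.prod_univ_three, succAbove_zero, succAbove_one, succAbove_two]

lemma mem_ker_cechD_two_iff (c : CechCochain P α 2) : c ∈ (cechD P α 2).ker ↔
    (P.map (fiberProj α (Fin.succAbove 0)).op).hom c *
      (P.map (fiberProj α (Fin.succAbove 2)).op).hom c =
    (P.map (fiberProj α (Fin.succAbove 3)).op).hom c *
      (P.map (fiberProj α (Fin.succAbove 1)).op).hom c := by
  have alternating_prod {A : Type w} [CommGroup A] (a : Fin 4 → A) :
      ∏ i, a i ^ ((-1 : ℤ) ^ (i : ℕ)) = (a 0 * a 2) * (a 3 * a 1)⁻¹ := by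
    simp only [Fin.prod_univ_four, Fin.val_zero, Fin.val_one, Fin.val_two,
      show ((3 : Fin 4) : ℕ) = 3 from rfl, show (-1 : ℤ) ^ 3 = -1 from rfl, pow_zero, pow_one,
      neg_one_sq, zpow_one, zpow_neg, mul_inv]
    rw [mul_right_comm (a 0), mul_assoc (a 0 * a 2), mul_comm (a 1)⁻¹]
  rw [MonoidHom.mem_ker, cechD_apply,
    alternating_prod fun i => (P.map (fiberProj α i.succAbove).op).hom c, mul_inv_eq_one]

end Cech

/-! ### Gluings and their defects -/

section UnitAct

variable {A : Type*} [Category* A] [MonoidalCategory A]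

-- Both products compare the composite `M₃ ⟶ M₂ ⟶ M₁ ⟶ M₀` with `e₀₃`.
lemma unit_mul_eq_of_simplex {M₀ M₁ M₂ M₃ : A} (hM₃ : TensorInvertible M₃) {e₀₁ : M₁ ≅ M₀}
    {e₀₂ : M₂ ≅ M₀} {e₁₂ : M₂ ≅ M₁} {e₀₃ : M₃ ≅ M₀} {e₁₃ : M₃ ≅ M₁} {e₂₃ : M₃ ≅ M₂}
    {ζ₁₂₃ ζ₀₂₃ ζ₀₁₃ ζ₀₁₂ : Aut (𝟙_ A)}
    (h₁₂₃ : e₂₃.hom ≫ e₁₂.hom = (unitAct ζ₁₂₃ M₃).hom ≫ e₁₃.hom)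
    (h₀₂₃ : e₂₃.hom ≫ e₀₂.hom = (unitAct ζ₀₂₃ M₃).hom ≫ e₀₃.hom)
    (h₀₁₃ : e₁₃.hom ≫ e₀₁.hom = (unitAct ζ₀₁₃ M₃).hom ≫ e₀₃.hom)
    (h₀₁₂ : e₁₂.hom ≫ e₀₁.hom = (unitAct ζ₀₁₂ M₂).hom ≫ e₀₂.hom) :
    ζ₁₂₃ * ζ₀₁₃ = ζ₀₁₂ * ζ₀₂₃ := by
  have act_comp_eq : (unitAct (ζ₀₁₃ * ζ₁₂₃) M₃).hom ≫ e₀₃.hom =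
      (unitAct (ζ₀₂₃ * ζ₀₁₂) M₃).hom ≫ e₀₃.hom := by
    rw [unitAct_mul, unitAct_mul, Category.assoc, Category.assoc, ← h₀₁₃, ← h₀₂₃,
      ← reassoc_of% h₁₂₃, h₀₁₂, ← Category.assoc, ← Category.assoc, unitAct_naturality]
  rw [mul_comm ζ₁₂₃, mul_comm ζ₀₁₂]
  exact (unitAct_bijective hM₃).1 (Iso.ext ((cancel_mono _).1 act_comp_eq))

lemma triangle_of_twisted_conj {M₀ M₁ M₂ N₀ N₁ N₂ : A} (f₀ : M₀ ≅ N₀) (f₁ : M₁ ≅ N₁) (f₂ : M₂ ≅ N₂)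
    {e₀₁ : M₁ ≅ M₀} {e₀₂ : M₂ ≅ M₀} {e₁₂ : M₂ ≅ M₁} {e₀₁' : N₁ ≅ N₀}
    {e₀₂' : N₂ ≅ N₀} {e₁₂' : N₂ ≅ N₁} {c₀₁ c₀₂ c₁₂ ζ : Aut (𝟙_ A)}
    (h₀₁ : f₁.hom ≫ e₀₁'.hom = (unitAct c₀₁ M₁).hom ≫ e₀₁.hom ≫ f₀.hom)
    (h₀₂ : f₂.hom ≫ e₀₂'.hom = (unitAct c₀₂ M₂).hom ≫ e₀₂.hom ≫ f₀.hom)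
    (h₁₂ : f₂.hom ≫ e₁₂'.hom = (unitAct c₁₂ M₂).hom ≫ e₁₂.hom ≫ f₁.hom)
    (hζ : e₁₂.hom ≫ e₀₁.hom = (unitAct ζ M₂).hom ≫ e₀₂.hom) :
    e₁₂'.hom ≫ e₀₁'.hom = (unitAct (ζ * (c₁₂ * c₀₂⁻¹ * c₀₁)) N₂).hom ≫ e₀₂'.hom := by
  have reorder : ζ * (c₁₂ * c₀₂⁻¹ * c₀₁) = c₀₂⁻¹ * (ζ * (c₀₁ * c₁₂)) := by
    rw [mul_comm c₀₁, mul_left_comm c₀₂⁻¹, mul_right_comm c₁₂, mul_comm c₀₂⁻¹]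
  have h₀₂' : e₀₂.hom ≫ f₀.hom = (unitAct c₀₂⁻¹ M₂).hom ≫ f₂.hom ≫ e₀₂'.hom := by
    rw [h₀₂, ← Category.assoc, ← unitAct_mul, mul_inv_cancel, unitAct_one, Category.id_comp]
  rw [reorder, ← cancel_epi f₂.hom, reassoc_of% h₁₂, h₀₁,
    ← reassoc_of% unitAct_naturality c₀₁ e₁₂.hom, reassoc_of% hζ, h₀₂',
    ← reassoc_of% unitAct_naturality _ f₂.hom, unitAct_mul, unitAct_mul, unitAct_mul]
  simp only [Category.assoc]

lemma triangle_tensor [BraidedCategory A] {M₀ M₁ M₂ N₀ N₁ N₂ : A}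
    {e₀₁ : M₁ ⟶ M₀} {e₀₂ : M₂ ⟶ M₀} {e₁₂ : M₂ ⟶ M₁} {e₀₁' : N₁ ⟶ N₀}
    {e₀₂' : N₂ ⟶ N₀} {e₁₂' : N₂ ⟶ N₁} {ζ ζ' : Aut (𝟙_ A)}
    (h : e₁₂ ≫ e₀₁ = (unitAct ζ M₂).hom ≫ e₀₂) (h' : e₁₂' ≫ e₀₁' = (unitAct ζ' N₂).hom ≫ e₀₂') :
    (e₁₂ ⊗ₘ e₁₂') ≫ (e₀₁ ⊗ₘ e₀₁') = (unitAct (ζ * ζ') (M₂ ⊗ N₂)).hom ≫ (e₀₂ ⊗ₘ e₀₂') := by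
  rw [tensorHom_comp_tensorHom, h, h', ← tensorHom_comp_tensorHom, mul_comm, unitAct_mul,
    unitAct_tensor_left, unitAct_tensor_right, ← MonoidalCategory.tensorHom_def]

end UnitAct

section Gluing

variable {k : Type u} [Field k] {G : Type v} [Group G] [Finite G] {U X : FinGSet.{v} G} {α : U ⟶ X}

lemma pull_map_pull_map {Y Z Z' : FinGSet.{v} G} (γ : Z' ⟶ Z) (β : Z ⟶ Y) {V V' : StRep k Y}
    (f : V ⟶ V') : (pull k γ).map ((pull k β).map f) = (pull k (γ ≫ β)).map f := by
  obtain ⟨f, rfl⟩ := (toStable _).map_surjective (X := V.as) (Y := V'.as) f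
  rfl

/-- The isomorphism `pr_j^* W ≅ pr_i^* W` over a fibre power obtained by pulling back a gluing along
the projection `pr_{ij}`; for triple fibre powers it is `Gluing.pullTo`. -/
noncomputable def Gluing.at {W : StRep k U} (ξ : Gluing k α W) {n : ℕ} (i j : Fin (n + 1)) :
    (pull k (factor α j)).obj W ≅ (pull k (factor α i)).obj W :=
  (pull k (fiberProj α ![i, j])).mapIso ξ

lemma Gluing.pullTo_eq_at {W : StRep k U} (ξ : Gluing k α W) (i j : Fin 3) :
    ξ.pullTo i j = ξ.at i j :=
  Iso.ext ((Category.id_comp _).trans (Category.comp_id _))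

lemma Gluing.pull_at {W : StRep k U} (ξ : Gluing k α W) {m n : ℕ} (s : Fin (m + 1) → Fin (n + 1))
    (i j : Fin (m + 1)) :
    (pull k (fiberProj α s)).map (ξ.at i j).hom = (ξ.at (s i) (s j)).hom := by
  have proj_comp : fiberProj α s ≫ fiberProj α ![i, j] = fiberProj α ![s i, s j] := by
    change fiberProj α (s ∘ ![i, j]) = _
    congr 1
    funext l
    fin_cases l <;> rfl
  exact (pull_map_pull_map _ _ ξ.hom).trans
    (eq_of_heq (congr_arg_heq (fun β => (pull k β).map ξ.hom) proj_comp))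

/-- A unit of the presheaf `unitsGm` as an automorphism of the tensor unit. -/
abbrev asAut {Y : FinGSet.{v} G} (ζ : (unitsGm k G).obj (Opposite.op Y)) : Aut (𝟙_ (StRep k Y)) := ζ

lemma isDefect_iff {W : StRep k U} {ξ : Gluing k α W} {ζ : CechCochain (unitsGm k G) α 2} :
    IsDefect ξ ζ ↔ (ξ.at (1 : Fin 3) 2).hom ≫ (ξ.at (0 : Fin 3) 1).hom =
      (unitAct (asAut ζ) ((pull k (factor α (2 : Fin 3))).obj W)).hom ≫
        (ξ.at (0 : Fin 3) 2).hom := by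
  rw [IsDefect, Gluing.defect, Gluing.pullTo_eq_at, Gluing.pullTo_eq_at, Gluing.pullTo_eq_at,
    Iso.ext_iff, Iso.trans_hom, Iso.trans_hom, Iso.symm_hom, ← Category.assoc, Iso.eq_comp_inv,
    eq_comm]

lemma IsDefect.pullback {W : StRep k U} {ξ : Gluing k α W} {ζ : CechCochain (unitsGm k G) α 2}
    (h : IsDefect ξ ζ) {n : ℕ} (s : Fin 3 → Fin (n + 1)) :
    (ξ.at (s 1) (s 2)).hom ≫ (ξ.at (s 0) (s 1)).hom =
      (unitAct (asAut (((unitsGm k G).map (fiberProj α s).op).hom ζ))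
        ((pull k (factor α (s 2))).obj W)).hom ≫ (ξ.at (s 0) (s 2)).hom := by
  have pulled := congrArg (pull k (fiberProj α s)).map (isDefect_iff.1 h)
  rw [Functor.map_comp, Functor.map_comp, map_unitAct] at pulled
  refine Eq.trans (congrArg₂ (· ≫ ·) (ξ.pull_at s 1 2).symm (ξ.pull_at s 0 1).symm)
    (pulled.trans ?_)
  exact congrArg (_ ≫ ·) (ξ.pull_at s 0 2)

lemma IsDefect.mem_ker {W : StRep k U} (hW : TensorInvertible W) {ξ : Gluing k α W}
    {ζ : CechCochain (unitsGm k G) α 2} (h : IsDefect ξ ζ) :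
    ζ ∈ (cechD (unitsGm k G) α 2).ker := by
  rw [mem_ker_cechD_two_iff]
  exact unit_mul_eq_of_simplex (hW.map (pull k (factor α (3 : Fin 4))))
    (e₀₁ := ξ.at 0 1) (e₀₂ := ξ.at 0 2) (e₁₂ := ξ.at 1 2) (e₀₃ := ξ.at 0 3) (e₁₃ := ξ.at 1 3)
    (e₂₃ := ξ.at 2 3) (h.pullback (Fin.succAbove 0)) (h.pullback (Fin.succAbove 1))
    (h.pullback (Fin.succAbove 2)) (h.pullback (Fin.succAbove 3))

/-- The isomorphism `φ` carries the gluing `ξ`, rescaled by the unit `c`, to the gluing `ξ'`. -/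
def TwistedConj {W W' : StRep k U} (φ : W ≅ W') (ξ : Gluing k α W) (ξ' : Gluing k α W')
    (c : CechCochain (unitsGm k G) α 1) : Prop :=
  (pull k (factor α (1 : Fin 2))).map φ.hom ≫ ξ'.hom =
    (unitAct (asAut c) _).hom ≫ ξ.hom ≫ (pull k (factor α (0 : Fin 2))).map φ.hom

lemma TwistedConj.at {W W' : StRep k U} {φ : W ≅ W'} {ξ : Gluing k α W} {ξ' : Gluing k α W'}
    {c : CechCochain (unitsGm k G) α 1} (h : TwistedConj φ ξ ξ' c) {n : ℕ} (i j : Fin (n + 1)) :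
    (pull k (factor α j)).map φ.hom ≫ (ξ'.at i j).hom =
      (unitAct (asAut (((unitsGm k G).map (fiberProj α ![i, j]).op).hom c)) _).hom ≫
        (ξ.at i j).hom ≫ (pull k (factor α i)).map φ.hom := by
  have pulled := congrArg (pull k (fiberProj α ![i, j])).map h
  simp only [Functor.map_comp, map_unitAct] at pulled
  refine Eq.trans (congrArg (· ≫ _) (pull_map_pull_map (fiberProj α ![i, j]) (factor α 1) _).symm)
    (pulled.trans ?_)
  exact congrArg (_ ≫ _ ≫ ·) (pull_map_pull_map (fiberProj α ![i, j]) (factor α 0) _)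

lemma IsDefect.conj {W W' : StRep k U} {φ : W ≅ W'} {ξ : Gluing k α W} {ξ' : Gluing k α W'}
    {c : CechCochain (unitsGm k G) α 1} (h : TwistedConj φ ξ ξ' c)
    {ζ : CechCochain (unitsGm k G) α 2} (hζ : IsDefect ξ ζ) :
    IsDefect ξ' (ζ * cechD (unitsGm k G) α 1 c) := by
  rw [isDefect_iff] at hζ ⊢
  rw [cechD_one_apply]
  exact triangle_of_twisted_conj ((pull k (factor α (0 : Fin 3))).mapIso φ)
    ((pull k (factor α (1 : Fin 3))).mapIso φ) ((pull k (factor α (2 : Fin 3))).mapIso φ)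
    (h.at 0 1) (h.at 0 2) (h.at 1 2) hζ

lemma exists_twistedConj {W W' : StRep k U} (hW : TensorInvertible W) (φ : W ≅ W')
    (ξ : Gluing k α W) (ξ' : Gluing k α W') : ∃ c, TwistedConj φ ξ ξ' c := by
  obtain ⟨c, hc⟩ := (unitAct_bijective (hW.map (pull k (factor α (1 : Fin 2))))).2
    ((pull k (factor α (1 : Fin 2))).mapIso φ ≪≫ ξ' ≪≫
      (pull k (factor α (0 : Fin 2))).mapIso φ.symm ≪≫ ξ.symm)
  refine ⟨c, Eq.trans ?_ (congrArg (· ≫ _) (congrArg Iso.hom hc).symm)⟩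
  simp [← Functor.map_comp]

/-- The tensor product of gluings. -/
noncomputable def Gluing.tensor {W W' : StRep k U} (ξ : Gluing k α W) (ξ' : Gluing k α W') :
    Gluing k α (W ⊗ W') :=
  (Functor.Monoidal.μIso (pull k (factor α (1 : Fin 2))) W W').symm ≪≫ (ξ ⊗ᵢ ξ') ≪≫
    Functor.Monoidal.μIso (pull k (factor α (0 : Fin 2))) W W'

lemma Gluing.tensor_at {W W' : StRep k U} (ξ : Gluing k α W) (ξ' : Gluing k α W') {n : ℕ}
    (i j : Fin (n + 1)) :
    ((ξ.tensor ξ').at i j).hom = (ξ.at i j).hom ⊗ₘ (ξ'.at i j).hom := by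
  have tensor_hom : (ξ.tensor ξ').hom = ξ.hom ⊗ₘ ξ'.hom :=
    (Category.id_comp _).trans (Category.comp_id _)
  obtain ⟨f, hf⟩ := (toStable _).map_surjective
    (X := (res k (factor α (1 : Fin 2))).obj W.as) (Y := (res k (factor α (0 : Fin 2))).obj W.as)
    ξ.hom
  obtain ⟨f', hf'⟩ := (toStable _).map_surjective
    (X := (res k (factor α (1 : Fin 2))).obj W'.as) (Y := (res k (factor α (0 : Fin 2))).obj W'.as)
    ξ'.hom
  refine (congrArg (pull k (fiberProj α ![i, j])).map tensor_hom).trans ?_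
  simp only [Gluing.at, Functor.mapIso_hom, ← hf, ← hf']
  rfl

lemma IsDefect.tensor {W W' : StRep k U} {ξ : Gluing k α W} {ξ' : Gluing k α W'}
    {ζ ζ' : CechCochain (unitsGm k G) α 2} (h : IsDefect ξ ζ) (h' : IsDefect ξ' ζ') :
    IsDefect (ξ.tensor ξ') (ζ * ζ') := by
  rw [isDefect_iff] at *
  rw [Gluing.tensor_at, Gluing.tensor_at, Gluing.tensor_at]
  exact triangle_tensor h h'

lemma exists_gluing_pull (V : StRep k X) :
    ∃ ξ : Gluing k α ((pull k α).obj V), IsDefect ξ 1 := by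
  let ξ : Gluing k α ((pull k α).obj V) :=
    pullTrans k (factor α (1 : Fin 2)) α (factor α (0 : Fin 2) ≫ α) (factor_comp α 1 1 0) V
  have ξ_at (i j : Fin 3) : (ξ.at i j).hom = eqToHom
      (congrArg (fun γ => (pull k γ).obj V) (factor_comp α 2 j i)) :=
    eqToHom_map (pull k (fiberProj α ![i, j]))
      (congrArg (fun γ => (pull k γ).obj V) (factor_comp α 1 1 0))
  refine ⟨ξ, ?_⟩
  rw [isDefect_iff, ξ_at, ξ_at, ξ_at]
  refine Eq.trans ?_ ((congrArg (· ≫ _) (unitAct_one _)).trans (Category.id_comp _)).symm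
  exact eqToHom_trans _ _

end Gluing

/-! ### The obstruction class -/

section HasClass

variable {k : Type u} [Field k] {G : Type v} [Group G] [Finite G] {Y : FinGSet.{v} G}
  {w : (stPic k G).obj (Opposite.op Y)} {W : StRep k Y}

lemma HasClass.tensorInvertible (h : HasClass k w W) : TensorInvertible W :=
  Pic.tensorInvertible h

lemma HasClass.nonempty_iso (h : HasClass k w W) {W' : StRep k Y} (h' : HasClass k w W') :
    Nonempty (W ≅ W') :=
  toSkeleton_eq_toSkeleton_iff.1 (h.symm.trans h')

lemma HasClass.of_iso (h : HasClass k w W) {W' : StRep k Y} (e : W ≅ W') : HasClass k w W' :=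
  h.trans (congr_toSkeleton_of_iso e)

lemma HasClass.eq (h : HasClass k w W) {w' : (stPic k G).obj (Opposite.op Y)}
    (h' : HasClass k w' W) : w = w' :=
  Units.ext (h.trans h'.symm)

lemma HasClass.map (h : HasClass k w W) {Z : FinGSet.{v} G} (β : Z ⟶ Y) :
    HasClass k (((stPic k G).map β.op).hom w) ((pull k β).obj W) :=
  Pic.map_val (pull k β) h

lemma HasClass.mul (h : HasClass k w W) {w' : (stPic k G).obj (Opposite.op Y)} {W' : StRep k Y}
    (h' : HasClass k w' W') : HasClass k (w * w') (W ⊗ W') :=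
  (congrArg₂ (· * ·) h h').trans (Skeleton.toSkeleton_tensorObj W W').symm

lemma exists_hasClass (w : (stPic k G).obj (Opposite.op Y)) : ∃ W, HasClass k w W :=
  Pic.exists_rep _

lemma TensorInvertible.exists_hasClass (h : TensorInvertible W) : ∃ w, HasClass k w W :=
  isUnit_toSkeleton_iff.2 h

end HasClass

section Obstruction

variable {k : Type u} [Field k] {G : Type v} [Group G] [Finite G] {U X : FinGSet.{v} G} {α : U ⟶ X}

lemma HasClass.nonempty_gluing {w : (stPic k G).obj (Opposite.op U)} {W : StRep k U}
    (h : HasClass k w W) (hw : w ∈ cechH0 (stPic k G) α) : Nonempty (Gluing k α W) := by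
  have class_pr₁ := h.map (factor α (0 : Fin 2))
  rw [(mem_cechH0_iff _ _).1 hw] at class_pr₁
  exact (h.map (factor α (1 : Fin 2))).nonempty_iso class_pr₁

lemma existsUnique_isDefect {W : StRep k U} (hW : TensorInvertible W) (ξ : Gluing k α W) :
    ∃! ζ, IsDefect ξ ζ :=
  (unitAct_bijective (hW.map (pull k (factor α (2 : Fin 3))))).existsUnique ξ.defect

lemma IsDefect.exists_coboundary {W W' : StRep k U} {ξ : Gluing k α W} {ξ' : Gluing k α W'}
    {ζ ζ' : CechCochain (unitsGm k G) α 2} (h : IsDefect ξ ζ) (h' : IsDefect ξ' ζ')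
    (hW : TensorInvertible W) (φ : W ≅ W') : ∃ c, ζ' = ζ * cechD (unitsGm k G) α 1 c := by
  obtain ⟨c, hc⟩ := exists_twistedConj hW φ ξ ξ'
  exact ⟨c, (existsUnique_isDefect (hW.of_iso φ) ξ').unique h' (h.conj hc)⟩

lemma IsDefect.exists_gluing_defect_eq_refl {W : StRep k U} {ξ : Gluing k α W}
    {c : CechCochain (unitsGm k G) α 1} (h : IsDefect ξ (cechD (unitsGm k G) α 1 c)) :
    ∃ ξ' : Gluing k α W, ξ'.defect = Iso.refl _ := by
  let ξ' : Gluing k α W := unitAct (asAut c⁻¹) _ ≪≫ ξ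
  have conj : TwistedConj (Iso.refl W) ξ ξ' c⁻¹ := by simp [TwistedConj, ξ']
  have defect : IsDefect ξ' (cechD (unitsGm k G) α 1 c * cechD (unitsGm k G) α 1 c⁻¹) :=
    h.conj conj
  rw [map_inv, mul_inv_cancel] at defect
  exact ⟨ξ', defect.symm.trans (Iso.ext (unitAct_one _))⟩

lemma exists_isDefect (w : cechH0 (stPic k G) α) :
    ∃ (W : StRep k U) (ξ : Gluing k α W) (ζ : CechCochain (unitsGm k G) α 2),
      HasClass k w.val W ∧ IsDefect ξ ζ := by
  obtain ⟨W, hW⟩ := exists_hasClass w.val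
  obtain ⟨ξ⟩ := hW.nonempty_gluing w.property
  obtain ⟨ζ, hζ, -⟩ := existsUnique_isDefect hW.tensorInvertible ξ
  exact ⟨W, ξ, ζ, hW, hζ⟩

variable (k α) in
/-- The obstruction to descending a class along `α`, as a map `Ȟ⁰(α, StPic) → Ȟ²(α, 𝔾ₘ)`. It is
defined through chosen representatives; by `obstructionFun_eq_mk` the choices do not matter. -/
noncomputable def obstructionFun (w : cechH0 (stPic k G) α) : CechH (unitsGm k G) α 1 :=
  have h := (exists_isDefect w).choose_spec.choose_spec
  QuotientGroup.mk
    ⟨h.choose, h.choose_spec.2.mem_ker (HasClass.tensorInvertible h.choose_spec.1)⟩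

lemma obstructionFun_eq_mk {w : cechH0 (stPic k G) α} {W : StRep k U} (hW : HasClass k w.val W)
    {ξ : Gluing k α W} {ζ : CechCochain (unitsGm k G) α 2} (hζ : IsDefect ξ ζ) :
    obstructionFun k α w = QuotientGroup.mk ⟨ζ, hζ.mem_ker hW.tensorInvertible⟩ := by
  obtain ⟨hW₀, hζ₀⟩ := (exists_isDefect w).choose_spec.choose_spec.choose_spec
  obtain ⟨φ⟩ := hW₀.nonempty_iso hW
  obtain ⟨c, hc⟩ := hζ₀.exists_coboundary hζ hW₀.tensorInvertible φ
  refine QuotientGroup.eq.2 (Subgroup.mem_subgroupOf.2 ⟨c, ?_⟩)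
  exact (inv_mul_eq_iff_eq_mul.2 hc).symm

variable (k α) in
/-- The obstruction homomorphism `Ȟ⁰(α, StPic) → Ȟ²(α, 𝔾ₘ)` of a map of finite `G`-sets. -/
noncomputable def obstruction : cechH0 (stPic k G) α →* CechH (unitsGm k G) α 1 :=
  MonoidHom.mk' (obstructionFun k α) fun w w' => by
    obtain ⟨W, ξ, ζ, hW, hζ⟩ := exists_isDefect w
    obtain ⟨W', ξ', ζ', hW', hζ'⟩ := exists_isDefect w'
    rw [obstructionFun_eq_mk hW hζ, obstructionFun_eq_mk hW' hζ',
      obstructionFun_eq_mk (w := w * w') (hW.mul hW') (hζ.tensor hζ')]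
    rfl

lemma obstruction_eq_mk {w : cechH0 (stPic k G) α} {W : StRep k U} (hW : HasClass k w.val W)
    {ξ : Gluing k α W} {ζ : CechCochain (unitsGm k G) α 2} (hζ : IsDefect ξ ζ) :
    obstruction k α w = QuotientGroup.mk ⟨ζ, hζ.mem_ker hW.tensorInvertible⟩ :=
  obstructionFun_eq_mk hW hζ

lemma obstruction_map_eq_one (v : (stPic k G).obj (Opposite.op X)) :
    obstruction k α ⟨((stPic k G).map α.op).hom v, map_mem_cechH0 _ α v⟩ = 1 := by
  obtain ⟨V, hV⟩ := exists_hasClass v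
  obtain ⟨ξ, hξ⟩ := exists_gluing_pull (α := α) V
  exact obstruction_eq_mk (hV.map α) hξ

instance (x y : ActionGroupoid X) : Finite (x ⟶ y) :=
  inferInstanceAs (Finite (Subtype _))

lemma HasClass.exists_finVal {w : (stPic k G).obj (Opposite.op U)} {W : StRep k U}
    (h : HasClass k w W) : ∃ Y : Rp k (ActionGroupoid U), FinVal k Y ∧
      HasClass k w ((toStable _).obj Y) := by
  obtain ⟨Y, hY, ⟨e⟩⟩ := exists_finVal_of_tensorInvertible h.tensorInvertible
  exact ⟨Y, hY, h.of_iso e⟩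

lemma mem_range_of_obstruction_eq_one
    (hα : ∀ x : ActionGroupoid X, (Nat.card (Fib α x) : k) ≠ 0) {w : cechH0 (stPic k G) α}
    (hw : obstruction k α w = 1) : w.val ∈ ((stPic k G).map α.op).hom.range := by
  obtain ⟨W₀, hW₀⟩ := exists_hasClass w.val
  obtain ⟨W, hW, hwW⟩ := hW₀.exists_finVal
  obtain ⟨ξ⟩ := hwW.nonempty_gluing w.property
  obtain ⟨ζ, hζ, -⟩ := existsUnique_isDefect hwW.tensorInvertible ξ
  rw [obstruction_eq_mk hwW hζ, QuotientGroup.eq_one_iff, Subgroup.mem_subgroupOf] at hw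
  obtain ⟨c, rfl⟩ := hw
  obtain ⟨ξ', hξ'⟩ := hζ.exists_gluing_defect_eq_refl
  obtain ⟨V, hV, ⟨e⟩⟩ := exists_descent hα hW ξ' hξ'
  have hVinv : TensorInvertible (A := StRep k X) ((toStable _).obj V) :=
    hV.tensorInvertible_of_pull hα (hwW.tensorInvertible.of_iso e.symm)
  obtain ⟨v, hv⟩ := hVinv.exists_hasClass
  exact ⟨v, ((hv.map α).of_iso e).eq hwW⟩

lemma range_map_eq_map_ker_obstruction
    (hα : ∀ x : ActionGroupoid X, (Nat.card (Fib α x) : k) ≠ 0) :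
    ((stPic k G).map α.op).hom.range =
      (obstruction k α).ker.map (cechH0 (stPic k G) α).subtype := by
  ext w
  constructor
  · rintro ⟨v, rfl⟩
    exact ⟨_, obstruction_map_eq_one v, rfl⟩
  · rintro ⟨w, hw, rfl⟩
    exact mem_range_of_obstruction_eq_one hα hw

end Obstruction

/-! ### The cover `G/H → G/G` -/

section Orbit

variable {k : Type u} [Field k] {G : Type v} [Group G] [Finite G] {H : Subgroup G}

lemma card_fib_orbitProj (x : ActionGroupoid (orbit (⊤ : Subgroup G))) :
    Nat.card (Fib (orbitProj H) x) = H.index := by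
  let toCoset : Fib (orbitProj H) x ≃ G ⧸ H :=
    { toFun y := y.val.pt
      invFun a := ⟨⟨a⟩, ActionGroupoid.ext (Subsingleton.elim _ _)⟩
      left_inv _ := rfl
      right_inv _ := rfl }
  exact Nat.card_congr toCoset

variable (k H) in
lemma isObstructionHom_obstruction : IsObstructionHom (obstruction k (orbitProj H)) :=
  fun _ _ hW _ _ hζ => ⟨hζ.mem_ker hW.tensorInvertible, obstruction_eq_mk hW hζ⟩

lemma IsObstructionHom.eq {z z' : PicH0 k H →* UnitsH2 k H} (hz : IsObstructionHom z)
    (hz' : IsObstructionHom z') : z = z' := by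
  ext w
  obtain ⟨W, ξ, ζ, hW, hζ⟩ := exists_isDefect w
  obtain ⟨_, hzw⟩ := hz w W hW ξ ζ hζ
  obtain ⟨_, hzw'⟩ := hz' w W hW ξ ζ hζ
  exact hzw.trans hzw'.symm

end Orbit

end StackRep

theorem mainTheorem4 {k : Type u} [Field k] (p : ℕ) [Fact p.Prime] [CharP k p]
    {G : Type v} [Group G] [Finite G] (hG : p ∣ Nat.card G)
    (H : Subgroup G) (hH : H.index.Coprime p) :
    -- (a) the image of restriction lies in `Ȟ⁰`
    (∀ v, ((stPic k G).map (orbitProj H).op).hom v ∈ PicH0 k H) ∧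
    -- (b) every choice `(W, ξ)` exists and gives a unique unit `ζ`, which is a 2-cocycle ...
    (∀ w ∈ PicH0 k H, (∃ W, HasClass k w W) ∧
      ∀ W, HasClass k w W → Nonempty (Gluing k (orbitProj H) W) ∧
        ∀ ξ : Gluing k (orbitProj H) W, (∃! ζ, IsDefect ξ ζ) ∧
          ∀ ζ, IsDefect ξ ζ → ζ ∈ (cechD (unitsGm k G) (orbitProj H) 2).ker) ∧
    -- ... whose cohomology class depends neither on `ξ` nor on `W`
    (∀ w ∈ PicH0 k H, ∀ W W', HasClass k w W → HasClass k w W' →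
      ∀ (ξ : Gluing k (orbitProj H) W) (ξ' : Gluing k (orbitProj H) W') (ζ ζ'),
        IsDefect ξ ζ → IsDefect ξ' ζ' →
          ∃ c, ζ' = ζ * cechD (unitsGm k G) (orbitProj H) 1 c) ∧
    -- (c) the resulting well-defined homomorphism `z`
    ∃ z : PicH0 k H →* UnitsH2 k H, IsObstructionHom z ∧
      (∀ z' : PicH0 k H →* UnitsH2 k H, IsObstructionHom z' → z' = z) ∧
      -- (d) the image of restriction is the kernel of `z`
      ((stPic k G).map (orbitProj H).op).hom.range = z.ker.map (PicH0 k H).subtype ∧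
      -- (e) evaluation at the coset of `1` identifies the Picard group of `G/H` with `T(H)`, and
      -- `ker z` with the image of `T(G)`
      ∃ e : (stPic k G).obj (Opposite.op (orbit H)) ≃* EndoT k H,
        (∀ w, EndoT.incl k H (e w) = orbitPic k H w) ∧
        (z.ker.map (PicH0 k H).subtype).map e.toMonoidHom = (EndoT.res k H).range := by
  have hk : (H.index : k) ≠ 0 := by
    rw [Ne, CharP.cast_eq_zero_iff k p]
    exact fun h => (Fact.out : p.Prime).one_lt.ne' (Nat.Coprime.eq_one_of_dvd hH.symm h)
  have hz := isObstructionHom_obstruction k H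
  have range_eq_map_ker : ((stPic k G).map (orbitProj H).op).hom.range =
      (obstruction k (orbitProj H)).ker.map (PicH0 k H).subtype :=
    range_map_eq_map_ker_obstruction fun x => by rwa [card_fib_orbitProj]
  refine ⟨map_mem_cechH0 _ _, fun w hw => ⟨exists_hasClass w, fun W hW =>
      ⟨hW.nonempty_gluing hw, fun ξ => ⟨existsUnique_isDefect hW.tensorInvertible ξ,
        fun ζ hζ => hζ.mem_ker hW.tensorInvertible⟩⟩⟩,
    fun w _ W W' hW hW' ξ ξ' ζ ζ' hζ hζ' => ?_,
    obstruction k (orbitProj H), hz, fun z' hz' => hz'.eq hz, range_eq_map_ker,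
    orbitPicEquiv k H, incl_orbitPicEquiv k H, ?_⟩
  · obtain ⟨φ⟩ := hW.nonempty_iso hW'
    exact hζ.exists_coboundary hζ' hW.tensorInvertible φ
  · rw [← range_eq_map_ker]
    exact map_range_orbitPicEquiv k H
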